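/- Let $d\in\mathbb N$ and $\mathbb T^d=\mathbb R^d/\mathbb Z^d$. Let $a:\mathbb R^d\to[0,\infty)$ be measurable with $\int_{\mathbb R^d}a(z)\,dz=1$ and $\int_{\mathbb R^d}|z|^2a(z)\,dz<\infty$. Let $(\Omega,\mathcal F,P)$ be a probability space with an ergodic measure preserving dynamical system $\tau_s:\Omega\to\Omega$, $s\in\mathbb R$. Let $\mu_\omega(x,y;t)$ be a real function of $\omega\in\Omega$, $x,y\in\mathbb R^d$, $t\in\mathbb R$, jointly measurable and $\mathbb Z^d$-periodic in $x$ and in $y$, such that $0<\alpha_1\le\mu_\omega(x,y;t)\le\alpha_2$ for deterministic constants $\alpha_1,\alpha_2$ and $\mu_\omega(x,y;t+s)=\mu_{\tau_s\omega}(x,y;t)$ for all $\omega,x,y,t,s$. For $u\in L^2(\mathbb T^d)$ put $$(A_\omega(t)u)(\xi)=\int_{\mathbb R^d}\big(u(\xi-z)-u(\xi)\big)\,a(z)\,\mu_\omega(\xi,\xi-z;t)\,dz ,$$ a bounded operator on $L^2(\mathbb T^d)$, and let $A_\omega^*(t)$ be its adjoint in $L^2(\mathbb T^d)$. A solution of $-\partial_tp=A^*_\omega(t)p$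 on an interval $I$ is a function $p:I\to L^2(\mathbb T^d)$ such that, for all $s\le t$ in $I$, the function $r\mapsto A^*_\omega(r)p(r)$ is integrable on $[s,t]$ and $p(s)=p(t)+\int_s^tA^*_\omega(r)p(r)\,dr$. A stationary solution is a random function $p(\omega,t)$ with values in $L^2(\mathbb T^d)$, strongly measurable in $\omega$ up to null sets for each $t$, that almost surely solves this equation on $\mathbb R$ and satisfies, for every $s$, almost surely $p(\omega,t+s)=p(\tau_s\omega,t)$ for all $t$. For every $\omega\in\Omega$ and $N\in\mathbb R$ there is exactly one solution $p^N$ of $$-\partial_tp^N=A^*_\omega(t)p^N\quad\text{for } t\le N,\qquad p^N|_{t=N}=1 .$$ For every $\omega\in\Omega$ and $s\in\mathbb R$ the limit $$p_\infty(\cdot,s)=\lim_{N\to\infty}p^N(\cdot,s)$$ exists in $L^2(\mathbb T^d)$. The function $p_\infty$ is a stationary solution of $-\partial_tp=A^*_\omega(t)p$; moreover, for every $\omega$ it solves this equation on $\mathbb R$, satisfies $p_\infty(\omega,t+s)=p_\infty(\tau_s\omega,t)$ for all $s,t\in\mathbb R$, and lies in $C(\mathbb R;L^2(\mathbb T^d))$.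 For every $\omega$ and every $s\in\mathbb R$, $$\int_{\mathbb T^d}p_\infty(\xi,s)\,d\xi=1 ,\qquad 0<\pi_1\le p_\infty(\xi,s)\le\pi_2\quad\text{for almost all }\xi\in\mathbb T^d,$$ with deterministic constants $\pi_1,\pi_2$ (independent of $\omega$, $s$, $\xi$). Under this normalization the stationary solution is unique: if $q$ is a stationary solution such that almost surely $\int_{\mathbb T^d}q(\xi,s)\,d\xi=1$ for all $s\in\mathbb R$, then almost surely $q(\cdot,s)=p_\infty(\cdot,s)$ for all $s\in\mathbb R$. -/

import Mathlib

open MeasureTheory Set Filter Topology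

noncomputable section

/-- The torus `𝕋^d = (ℝ/ℤ)^d`. Functions on it are the functions on `ℝ^d` that are periodic with the
period cell `[0,1)^d`; its `volume` is Lebesgue measure on the period cell, of total mass one. -/
abbrev Torus (d : ℕ) : Type := Fin d → UnitAddCircle

/-- The projection `ℝ^d → 𝕋^d`. -/
def toTorus {d : ℕ} (z : EuclideanSpace ℝ (Fin d)) : Torus d := fun i => (z i : UnitAddCircle)

/-- The Hilbert space `L²(𝕋^d)`. -/
abbrev L2T (d : ℕ) : Type := Lp ℝ 2 (volume : Measure (Torus d))

/-- The conditions on the kernel: `a ≥ 0`, `∫ a = 1`, `∫ |z|² a(z) dz < ∞`. -/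
structure IsJumpKernel {d : ℕ} (a : EuclideanSpace ℝ (Fin d) → ℝ) : Prop where
  nonneg : ∀ z, 0 ≤ a z
  integrable : Integrable a
  integral_eq_one : ∫ z, a z = 1
  second_moment : Integrable (fun z => ‖z‖ ^ 2 * a z)

/-- A measurable coefficient `m(ξ, η)` on `𝕋^d × 𝕋^d` with `0 < α₁ ≤ m ≤ α₂`. -/
structure IsCoefficient {d : ℕ} (α₁ α₂ : ℝ) (m : Torus d → Torus d → ℝ) : Prop where
  measurable : Measurable (Function.uncurry m)
  pos : 0 < α₁
  lower : ∀ ξ η, α₁ ≤ m ξ η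
  upper : ∀ ξ η, m ξ η ≤ α₂

/-- The function `ξ ↦ ∫_{ℝ^d} (u(ξ - z) - u(ξ)) a(z) m(ξ, ξ - z) dz`. -/
def jumpFun {d : ℕ} (a : EuclideanSpace ℝ (Fin d) → ℝ) (m : Torus d → Torus d → ℝ)
    (u : Torus d → ℝ) (ξ : Torus d) : ℝ :=
  ∫ z : EuclideanSpace ℝ (Fin d), (u (ξ - toTorus z) - u ξ) * a z * m ξ (ξ - toTorus z)

/-! Helper facts: `jumpFun a m` induces a bounded linear operator on `L²(𝕋^d)`. -/

lemma measurable_toTorus {d : ℕ} : Measurable (toTorus (d := d)) := by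
  refine measurable_pi_lambda _ fun i => ?_
  have h : Measurable (fun z : EuclideanSpace ℝ (Fin d) => z i) := by fun_prop
  exact AddCircle.measurable_mk'.comp h

/-- The probability law with density `a`. -/
def jumpLaw {d : ℕ} (a : EuclideanSpace ℝ (Fin d) → ℝ) : Measure (EuclideanSpace ℝ (Fin d)) :=
  volume.withDensity fun z => ENNReal.ofReal (a z)

lemma isProbabilityMeasure_jumpLaw {d : ℕ} {a : EuclideanSpace ℝ (Fin d) → ℝ}
    (ha : IsJumpKernel a) : IsProbabilityMeasure (jumpLaw a) := by
  constructor
  rw [jumpLaw, withDensity_apply _ MeasurableSet.univ, Measure.restrict_univ,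
    ← ofReal_integral_eq_lintegral_ofReal ha.integrable (Eventually.of_forall ha.nonneg),
    ha.integral_eq_one, ENNReal.ofReal_one]

lemma jumpFun_eq {d : ℕ} {a : EuclideanSpace ℝ (Fin d) → ℝ} (ha : IsJumpKernel a)
    (m : Torus d → Torus d → ℝ) (u : Torus d → ℝ) (ξ : Torus d) :
    jumpFun a m u ξ =
      ∫ z, (u (ξ - toTorus z) - u ξ) * m ξ (ξ - toTorus z) ∂(jumpLaw a) := by
  rw [jumpLaw, integral_withDensity_eq_integral_toReal_smul₀
    ha.integrable.aestronglyMeasurable.aemeasurable.ennreal_ofReal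
    (Eventually.of_forall fun _ => ENNReal.ofReal_lt_top)]
  refine integral_congr_ae (Eventually.of_forall fun z => ?_)
  simp only [ENNReal.toReal_ofReal (ha.nonneg z), smul_eq_mul]
  ring

lemma measurePreserving_shift {d : ℕ} (ν : Measure (EuclideanSpace ℝ (Fin d)))
    [IsProbabilityMeasure ν] :
    MeasurePreserving (fun q : Torus d × EuclideanSpace ℝ (Fin d) => q.1 - toTorus q.2)
      ((volume : Measure (Torus d)).prod ν) volume := by
  have hm : Measurable
      (fun q : Torus d × EuclideanSpace ℝ (Fin d) => q.1 - toTorus q.2) :=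
    measurable_fst.sub (measurable_toTorus.comp measurable_snd)
  refine ⟨hm, ?_⟩
  ext s hs
  rw [Measure.map_apply hm hs, Measure.prod_apply_symm (hm hs)]
  have : ∀ z : EuclideanSpace ℝ (Fin d), (volume : Measure (Torus d))
      ((fun x => (x, z)) ⁻¹'
        ((fun q : Torus d × EuclideanSpace ℝ (Fin d) => q.1 - toTorus q.2) ⁻¹' s)) =
      volume s := fun z =>
    (measurePreserving_sub_right (volume : Measure (Torus d)) (toTorus z)).measure_preimage
      hs.nullMeasurableSet
  simp [this]

lemma eLpNorm_integral_prod_le {X Z : Type*} [MeasurableSpace X] [MeasurableSpace Z]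
    {ρ : Measure X} [SFinite ρ] {ν : Measure Z} [IsProbabilityMeasure ν] {F : X × Z → ℝ}
    (hF : AEStronglyMeasurable F (ρ.prod ν)) :
    eLpNorm (fun x => ∫ z, F (x, z) ∂ν) 2 ρ ≤ eLpNorm F 2 (ρ.prod ν) := by
  rw [eLpNorm_eq_lintegral_rpow_enorm_toReal (by norm_num) (by norm_num),
    eLpNorm_eq_lintegral_rpow_enorm_toReal (by norm_num) (by norm_num)]
  refine ENNReal.rpow_le_rpow ?_ (by positivity)
  rw [lintegral_prod _ (hF.enorm.pow_const _)]
  refine lintegral_mono_ae ?_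
  filter_upwards [hF.prodMk_left] with x hx
  have h1 : ‖∫ z, F (x, z) ∂ν‖ₑ ≤ eLpNorm (fun z => F (x, z)) 2 ν := by
    refine (enorm_integral_le_lintegral_enorm _).trans ?_
    rw [← eLpNorm_one_eq_lintegral_enorm]
    exact eLpNorm_le_eLpNorm_of_exponent_le (by norm_num) hx
  refine (ENNReal.rpow_le_rpow h1 (by positivity)).trans (le_of_eq ?_)
  rw [eLpNorm_eq_lintegral_rpow_enorm_toReal (by norm_num) (by norm_num), ← ENNReal.rpow_mul]
  norm_num

section Operator

variable {d : ℕ} {a : EuclideanSpace ℝ (Fin d) → ℝ} {α₁ α₂ : ℝ} {m : Torus d → Torus d → ℝ}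

lemma IsCoefficient.abs_le (hm : IsCoefficient α₁ α₂ m) (ξ η : Torus d) : |m ξ η| ≤ α₂ :=
  _root_.abs_le.2 ⟨by linarith [hm.pos, hm.lower ξ η, hm.upper ξ η], hm.upper ξ η⟩

lemma memLp_jumpIntegrand (ha : IsJumpKernel a) (hm : IsCoefficient α₁ α₂ m)
    {u : Torus d → ℝ} (hu : MemLp u 2) :
    MemLp (fun q : Torus d × EuclideanSpace ℝ (Fin d) =>
        (u (q.1 - toTorus q.2) - u q.1) * m q.1 (q.1 - toTorus q.2)) 2
      ((volume : Measure (Torus d)).prod (jumpLaw a)) ∧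
    eLpNorm (fun q : Torus d × EuclideanSpace ℝ (Fin d) =>
        (u (q.1 - toTorus q.2) - u q.1) * m q.1 (q.1 - toTorus q.2)) 2
      ((volume : Measure (Torus d)).prod (jumpLaw a)) ≤
      ENNReal.ofReal α₂ * (eLpNorm u 2 + eLpNorm u 2) := by
  have := isProbabilityMeasure_jumpLaw ha
  have hs := measurePreserving_shift (d := d) (jumpLaw a)
  have hf : MeasurePreserving (Prod.fst : Torus d × EuclideanSpace ℝ (Fin d) → Torus d)
      ((volume : Measure (Torus d)).prod (jumpLaw a)) volume := measurePreserving_fst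
  have h1 := hu.comp_measurePreserving hs
  have h2 := hu.comp_measurePreserving hf
  have hmm : Measurable (fun q : Torus d × EuclideanSpace ℝ (Fin d) =>
      m q.1 (q.1 - toTorus q.2)) := hm.measurable.comp (measurable_fst.prodMk hs.measurable)
  have hD := h1.sub h2
  have hb : ∀ᵐ q ∂((volume : Measure (Torus d)).prod (jumpLaw a)),
      ‖(u (q.1 - toTorus q.2) - u q.1) * m q.1 (q.1 - toTorus q.2)‖ ≤
      α₂ * ‖u (q.1 - toTorus q.2) - u q.1‖ := by
    refine Eventually.of_forall fun q => ?_
    rw [norm_mul, mul_comm]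
    exact mul_le_mul_of_nonneg_right (hm.abs_le _ _) (norm_nonneg _)
  refine ⟨hD.of_le_mul (hD.1.mul hmm.aestronglyMeasurable) hb, ?_⟩
  refine (eLpNorm_le_mul_eLpNorm_of_ae_le_mul hb 2).trans ?_
  refine mul_le_mul_right ((eLpNorm_sub_le h1.1 h2.1 (by norm_num)).trans ?_) _
  rw [eLpNorm_comp_measurePreserving hu.1 hs, eLpNorm_comp_measurePreserving hu.1 hf]

lemma eLpNorm_jumpFun_le (ha : IsJumpKernel a) (hm : IsCoefficient α₁ α₂ m)
    {u : Torus d → ℝ} (hu : MemLp u 2) :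
    eLpNorm (jumpFun a m u) 2 ≤ ENNReal.ofReal α₂ * (eLpNorm u 2 + eLpNorm u 2) := by
  have := isProbabilityMeasure_jumpLaw ha
  obtain ⟨h, hle⟩ := memLp_jumpIntegrand ha hm hu
  rw [funext (jumpFun_eq ha m u)]
  exact (eLpNorm_integral_prod_le h.1).trans hle

lemma memLp_jumpFun (ha : IsJumpKernel a) (hm : IsCoefficient α₁ α₂ m)
    {u : Torus d → ℝ} (hu : MemLp u 2) : MemLp (jumpFun a m u) 2 := by
  have := isProbabilityMeasure_jumpLaw ha
  refine ⟨?_, (eLpNorm_jumpFun_le ha hm hu).trans_lt ?_⟩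
  · rw [funext (jumpFun_eq ha m u)]
    exact (memLp_jumpIntegrand ha hm hu).1.1.integral_prod_right'
  · exact ENNReal.mul_lt_top ENNReal.ofReal_lt_top (ENNReal.add_lt_top.2 ⟨hu.2, hu.2⟩)

/-- `jumpFun` does not depend on the representative. -/
lemma jumpFun_congr (ha : IsJumpKernel a) (m : Torus d → Torus d → ℝ)
    {u v : Torus d → ℝ} (huv : u =ᵐ[volume] v) : jumpFun a m u =ᵐ[volume] jumpFun a m v := by
  have := isProbabilityMeasure_jumpLaw ha
  have h := Measure.ae_ae_of_ae_prod
    ((measurePreserving_shift (d := d) (jumpLaw a)).quasiMeasurePreserving.ae huv)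
  filter_upwards [huv, h] with ξ h1 h2
  rw [jumpFun_eq ha, jumpFun_eq ha]
  refine integral_congr_ae ?_
  filter_upwards [h2] with z hz
  rw [hz, h1]

lemma jumpFun_add (ha : IsJumpKernel a) (hm : IsCoefficient α₁ α₂ m)
    {u v : Torus d → ℝ} (hu : MemLp u 2) (hv : MemLp v 2) :
    jumpFun a m (u + v) =ᵐ[volume] jumpFun a m u + jumpFun a m v := by
  have := isProbabilityMeasure_jumpLaw ha
  have h1 := ((memLp_jumpIntegrand ha hm hu).1.integrable (by norm_num)).prod_right_ae
  have h2 := ((memLp_jumpIntegrand ha hm hv).1.integrable (by norm_num)).prod_right_ae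
  filter_upwards [h1, h2] with ξ h1 h2
  simp only [Pi.add_apply, jumpFun_eq ha]
  rw [← integral_add h1 h2]
  congr 1
  ext z
  ring

lemma jumpFun_smul (a : EuclideanSpace ℝ (Fin d) → ℝ) (m : Torus d → Torus d → ℝ) (c : ℝ)
    (u : Torus d → ℝ) : jumpFun a m (c • u) = c • jumpFun a m u := by
  ext ξ
  simp only [jumpFun, Pi.smul_apply, smul_eq_mul]
  rw [← integral_const_mul]
  congr 1
  ext z
  ring

/-- The bounded operator `A` on `L²(𝕋^d)`,
`(A u)(ξ) = ∫_{ℝ^d} (u(ξ - z) - u(ξ)) a(z) m(ξ, ξ - z) dz`. -/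
def jumpOp (ha : IsJumpKernel a) (hm : IsCoefficient α₁ α₂ m) : L2T d →L[ℝ] L2T d :=
  LinearMap.mkContinuous
    { toFun := fun u => (memLp_jumpFun ha hm (Lp.memLp u)).toLp (jumpFun a m u)
      map_add' := fun u v => by
        rw [← MemLp.toLp_add]
        exact MemLp.toLp_congr _ _ ((jumpFun_congr ha m (Lp.coeFn_add u v)).trans
          (jumpFun_add ha hm (Lp.memLp u) (Lp.memLp v)))
      map_smul' := fun c u => by
        rw [RingHom.id_apply, ← MemLp.toLp_const_smul]
        refine MemLp.toLp_congr _ _ ((jumpFun_congr ha m (Lp.coeFn_smul c u)).trans ?_)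
        rw [jumpFun_smul] }
    (2 * α₂) fun u => by
      have h0 : 0 ≤ α₂ := (abs_nonneg _).trans (hm.abs_le 0 0)
      have hu := (Lp.memLp u).2.ne
      rw [LinearMap.coe_mk, AddHom.coe_mk, Lp.norm_toLp, Lp.norm_def]
      refine (ENNReal.toReal_mono (ENNReal.mul_ne_top ENNReal.ofReal_ne_top
        (ENNReal.add_ne_top.2 ⟨hu, hu⟩)) (eLpNorm_jumpFun_le ha hm (Lp.memLp u))).trans
        (le_of_eq ?_)
      rw [ENNReal.toReal_mul, ENNReal.toReal_ofReal h0, ENNReal.toReal_add hu hu]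
      ring

end Operator

/-- A measure preserving ergodic dynamical system `(τ_s)_{s ∈ ℝ}` on the probability space
`(Ω, P)`. -/
structure IsErgodicFlow {Ω : Type*} [MeasurableSpace Ω] (P : Measure Ω) (τ : ℝ → Ω → Ω) :
    Prop where
  zero : ∀ ω, τ 0 ω = ω
  add : ∀ s t ω, τ (s + t) ω = τ s (τ t ω)
  measurePreserving : ∀ s, MeasurePreserving (τ s) P P
  ergodic : ∀ B : Set Ω, MeasurableSet B → (∀ s, τ s '' B = B) → P B = 0 ∨ P B = 1

/-- The random coefficient `μ_ω(ξ, η; t)`, written `μ ω t ξ η`: measurable, with deterministic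
bounds `0 < α₁ ≤ μ ≤ α₂`, and stationary in time with respect to `τ`. -/
structure IsStationaryMedium {d : ℕ} {Ω : Type*} [MeasurableSpace Ω] (τ : ℝ → Ω → Ω)
    (α₁ α₂ : ℝ) (μ : Ω → ℝ → Torus d → Torus d → ℝ) : Prop where
  measurable : Measurable fun q : Ω × ℝ × Torus d × Torus d => μ q.1 q.2.1 q.2.2.1 q.2.2.2
  pos : 0 < α₁
  lower : ∀ ω t ξ η, α₁ ≤ μ ω t ξ η
  upper : ∀ ω t ξ η, μ ω t ξ η ≤ α₂
  stationary : ∀ ω t s, μ ω (t + s) = μ (τ s ω) t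

lemma IsStationaryMedium.isCoefficient {d : ℕ} {Ω : Type*} [MeasurableSpace Ω] {τ : ℝ → Ω → Ω}
    {α₁ α₂ : ℝ} {μ : Ω → ℝ → Torus d → Torus d → ℝ} (hμ : IsStationaryMedium τ α₁ α₂ μ)
    (ω : Ω) (t : ℝ) : IsCoefficient α₁ α₂ (μ ω t) where
  measurable := hμ.measurable.comp
    (measurable_const.prodMk (measurable_const.prodMk measurable_id))
  pos := hμ.pos
  lower := hμ.lower ω t
  upper := hμ.upper ω t

/-- The random time dependent operators `A_ω(t)` on `L²(𝕋^d)`,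
`(A_ω(t) u)(ξ) = ∫_{ℝ^d} (u(ξ - z) - u(ξ)) a(z) μ_ω(ξ, ξ - z; t) dz`. -/
def mediumOp {d : ℕ} {Ω : Type*} [MeasurableSpace Ω] {τ : ℝ → Ω → Ω} {α₁ α₂ : ℝ}
    {μ : Ω → ℝ → Torus d → Torus d → ℝ} {a : EuclideanSpace ℝ (Fin d) → ℝ}
    (ha : IsJumpKernel a) (hμ : IsStationaryMedium τ α₁ α₂ μ) (ω : Ω) (t : ℝ) :
    L2T d →L[ℝ] L2T d :=
  jumpOp ha (hμ.isCoefficient ω t)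

/-- `p : ℝ → L²(𝕋^d)` solves `-∂_t p = A(t)^* p` on the time interval `I`, in the integrated
(Carathéodory) sense: the coefficients are only measurable in `t`. Here `A(t)^*` is the adjoint of
`A(t)` in `L²(𝕋^d)` and the integral is the Bochner integral in `L²(𝕋^d)`. -/
def IsBackwardSolution {d : ℕ} (A : ℝ → L2T d →L[ℝ] L2T d) (I : Set ℝ) (p : ℝ → L2T d) : Prop :=
  ∀ s ∈ I, ∀ t ∈ I, s ≤ t →
    IntervalIntegrable (fun r => ContinuousLinearMap.adjoint (A r) (p r)) volume s t ∧
    p s = p t + ∫ r in s..t, ContinuousLinearMap.adjoint (A r) (p r)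

/-- `p` solves `-∂_t p = A(t)^* p` for `t ≤ N`, with `p = 1` at `t = N`. -/
def IsTerminalSolution {d : ℕ} (A : ℝ → L2T d →L[ℝ] L2T d) (N : ℝ) (p : ℝ → L2T d) : Prop :=
  IsBackwardSolution A (Iic N) p ∧ p N = Lp.const 2 volume (1 : ℝ)

/-- `p` is a stationary solution of `-∂_t p = A_ω(t)^* p`, `t ∈ ℝ`: a random function with values
in `L²(𝕋^d)` that almost surely solves the equation and is stationary with respect to `τ`. -/
structure IsStationarySolution {d : ℕ} {Ω : Type*} [MeasurableSpace Ω] (P : Measure Ω)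
    (τ : ℝ → Ω → Ω) (A : Ω → ℝ → L2T d →L[ℝ] L2T d) (p : Ω → ℝ → L2T d) : Prop where
  measurable : ∀ s, AEStronglyMeasurable (fun ω => p ω s) P
  solves : ∀ᵐ ω ∂P, IsBackwardSolution (A ω) univ (p ω)
  stationary : ∀ s, ∀ᵐ ω ∂P, ∀ t, p ω (t + s) = p (τ s ω) t

end

noncomputable section

/-! ### Backward evolution equations with bounded, measurable generators: Picard iteration and
uniqueness. -/

section Evolution

/-! The backward flow preserves mass and positivity, and within one unit of time it forgets a fixed
fraction of its terminal data, uniformly in the realization. This gives the limit, and applied to a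
second stationary solution it gives uniqueness.

Let `J` be averaging over the law of one jump. The bounds on the coefficient give, for `φ ≥ 0`, the
inequalities `α₁ J φ ≤ (A + α₂) φ ≤ α₂ J φ + (α₂ - α₁) φ` (`jumpOp_bounds`). Everything about the
adjoint is read off by pairing with nonnegative test functions. Since `A* + α₂` is positive, the
equation is solved through a Duhamel formula with the generator shifted by `α₂`; this formula is a
convex average, so any closed convex set invariant under `1 + A*/α₂` is invariant under the flow
(`evol_mem`). This yields positivity and a uniform upper bound for densities started from `1`
(`exists_mediumSol_le`).

For the lower bound, iterating Duhamel `k` times bounds the solution below by a multiple of the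
adjoint of `J^k` applied to the data (`inner_mediumSol_ge`). The jump law has a density on the
torus, hence by a Steinhaus argument some convolution power of it has a density bounded below
(`exists_walkMinorized_univ`). So a density is at least `δ` times its mass after unit time
(`exists_doeblin`). Evolving the positive and negative parts of zero-mean data and cancelling the
common lower bound contracts the `L¹` norm by `1 - δ` per unit time (`exists_massNorm_contraction`).

Two solutions started from `1` at late times are therefore `L¹`-close at time `s`. Both lie below
the same constant, so they are also `L²`-close, and the limit exists (`tendsto_mediumSol`); the
equation, the mass, the bounds and the shift covariance pass to the limit. If `q` is another
normalized stationary solution, the `L¹` distance `X` at a fixed time satisfies `X(ω) ≤ (1 - δ)^k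
X(τ_k ω)`. Since `X ∘ τ_k` has the same law as `X`, the right side tends to zero in probability, so
`X = 0` almost surely (`ae_eq_zero_of_le_pow_mul_comp`). -/

lemma intervalIntegrable_of_bounded {E : Type*} [NormedAddCommGroup E] {f : ℝ → E} {a b R : ℝ}
    (hf : AEStronglyMeasurable f (volume.restrict (uIoc a b))) (hR : ∀ r ∈ uIoc a b, ‖f r‖ ≤ R) :
    IntervalIntegrable f volume a b := by
  rw [intervalIntegrable_iff]
  have : IsFiniteMeasure (volume.restrict (uIoc a b)) := by
    unfold uIoc
    infer_instance
  refine Integrable.of_bound hf R ?_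
  filter_upwards [ae_restrict_mem measurableSet_uIoc] with r hr using hR r hr

variable {E : Type*} [NormedAddCommGroup E] [NormedSpace ℝ E]

/-- Measurability of the generator is only available vector by vector, not in operator norm.
Continuity in the vector makes the evaluation a Carathéodory function, hence jointly measurable. -/
lemma stronglyMeasurable_clm_apply [SecondCountableTopology E] {α : Type*} [MeasurableSpace α]
    {L : α → E →L[ℝ] E} (hL : ∀ x, StronglyMeasurable fun r => L r x) {f : α → E}
    (hf : StronglyMeasurable f) : StronglyMeasurable fun r => L r (f r) := by
  borelize E
  have h : StronglyMeasurable (Function.uncurry fun (x : E) (r : α) => L r x) :=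
    stronglyMeasurable_uncurry_of_continuous_of_stronglyMeasurable
      (fun r => (L r).continuous) hL
  exact h.comp_measurable (hf.measurable.prodMk measurable_id)

lemma aestronglyMeasurable_clm_apply [SecondCountableTopology E] {α : Type*} [MeasurableSpace α]
    {ν : Measure α} {L : α → E →L[ℝ] E} (hL : ∀ x, StronglyMeasurable fun r => L r x) {f : α → E}
    (hf : AEStronglyMeasurable f ν) : AEStronglyMeasurable (fun r => L r (f r)) ν := by
  refine ⟨fun r => L r (hf.mk f r), stronglyMeasurable_clm_apply hL hf.stronglyMeasurable_mk, ?_⟩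
  filter_upwards [hf.ae_eq_mk] with r hr
  rw [← hr]

/-- A bound with exponential weight is halved by integration. -/
lemma norm_integral_le_half_exp {w : ℝ → E} {D K s N : ℝ} (hK : 0 ≤ K) (hs : s ≤ N)
    (h : ∀ r ∈ Icc s N, ‖w r‖ ≤ D * (K * Real.exp (2 * D * (N - r)))) :
    ‖∫ r in s..N, w r‖ ≤ K / 2 * Real.exp (2 * D * (N - s)) := by
  have h1 : ‖∫ r in s..N, w r‖ ≤ ∫ r in s..N, D * (K * Real.exp (2 * D * (N - r))) := by
    refine intervalIntegral.norm_integral_le_of_norm_le hs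
      (Eventually.of_forall fun r hr => h r ⟨hr.1.le, hr.2⟩) ?_
    exact Continuous.intervalIntegrable (by fun_prop) _ _
  have h2 : ∫ r in s..N, D * (K * Real.exp (2 * D * (N - r))) =
      -(K / 2 * Real.exp (2 * D * (N - N))) - -(K / 2 * Real.exp (2 * D * (N - s))) := by
    refine intervalIntegral.integral_eq_sub_of_hasDerivAt
      (f := fun r => -(K / 2 * Real.exp (2 * D * (N - r)))) (fun r _ => ?_)
      (Continuous.intervalIntegrable (by fun_prop) _ _)
    have h3 : HasDerivAt (fun r => 2 * D * (N - r)) (2 * D * (-1)) r :=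
      ((hasDerivAt_id r).const_sub N).const_mul _
    refine ((h3.exp.const_mul (K / 2)).neg).congr_deriv ?_
    ring
  rw [h2] at h1
  refine h1.trans ?_
  have := Real.exp_pos (2 * D * (N - N))
  have := mul_nonneg (half_pos zero_lt_two).le (mul_nonneg hK this.le)
  linarith

/-- A function whose increments are quadratically small is constant. -/
lemma eq_of_norm_sub_le_sq {D : ℝ → E} {a b K : ℝ} (hab : a ≤ b)
    (h : ∀ s ∈ Icc a b, ∀ t ∈ Icc a b, s ≤ t → ‖D t - D s‖ ≤ K * (t - s) ^ 2) : D b = D a := by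
  have h' : ∀ s ∈ Icc a b, ∀ t ∈ Icc a b, ‖D t - D s‖ ≤ K * ‖t - s‖ ^ 2 := by
    intro s hs t ht
    rw [Real.norm_eq_abs, sq_abs]
    rcases le_total s t with hst | hst
    · exact h s hs t ht hst
    · rw [norm_sub_rev, ← neg_sub s t, neg_sq]
      exact h t ht s hs hst
  have hd : ∀ s ∈ Icc a b, HasDerivWithinAt D 0 (Icc a b) s := by
    intro s hs
    rw [hasDerivWithinAt_iff_hasFDerivWithinAt]
    refine HasFDerivWithinAt.congr_fderiv (f' := 0) ?_ (by ext; simp)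
    rw [hasFDerivWithinAt_iff_isLittleO]
    have h1 : (fun t => D t - D s - (0 : ℝ →L[ℝ] E) (t - s)) =O[𝓝[Icc a b] s]
        fun t => ‖t - s‖ ^ 2 := by
      refine Asymptotics.IsBigO.of_bound K ?_
      filter_upwards [self_mem_nhdsWithin] with t ht
      simpa using h' s hs t ht
    refine h1.trans_isLittleO ?_
    have h2 : (fun t : ℝ => ‖t - s‖ ^ 2) =o[𝓝 s] fun t => t - s :=
      Asymptotics.isLittleO_norm_pow_id (E' := ℝ) one_lt_two |>.comp_tendsto
        (Continuous.tendsto' (by fun_prop) _ _ (sub_self s))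
    exact h2.mono nhdsWithin_le_nhds
  refine constant_of_has_deriv_right_zero (fun s hs => (hd s hs).continuousWithinAt) ?_ b
    (right_mem_Icc.2 hab)
  intro s hs
  exact (hd s ⟨hs.1, hs.2.le⟩).mono_of_mem_nhdsWithin (Icc_mem_nhdsGE_of_mem hs)

variable (L : ℝ → E →L[ℝ] E)

/-- Solutions of `-∂_t p = L(t) p` on `I` in the integrated sense. -/
def IsBackwardSol (I : Set ℝ) (p : ℝ → E) : Prop :=
  ∀ s ∈ I, ∀ t ∈ I, s ≤ t →
    IntervalIntegrable (fun r => L r (p r)) volume s t ∧ p s = p t + ∫ r in s..t, L r (p r)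

/-- The integrand of the Duhamel formula after the shift of the generator by `c`. -/
def duhamelIntegrand (c : ℝ) (f : ℝ → E) (r : ℝ) : E :=
  Real.exp (-(c * r)) • (L r (f r) + c • f r)

/-- The Duhamel operator whose fixed points solve the terminal value problem. -/
def duhamel (c N : ℝ) (x : E) (f : ℝ → E) (s : ℝ) : E :=
  Real.exp (c * s) • (Real.exp (-(c * N)) • x + ∫ r in s..N, duhamelIntegrand L c f r)

/-- Picard iterates of the Duhamel operator. -/
def picard (c N : ℝ) (x : E) (n : ℕ) : ℝ → E := (duhamel L c N x)^[n] fun _ => x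

/-- The solution of the terminal value problem with value `x` at time `N`. -/
def evol (c N : ℝ) (x : E) (s : ℝ) : E := limUnder atTop fun n => picard L c N x n s

variable {L} {c C N : ℝ} {x : E}

lemma picard_succ (n : ℕ) : picard L c N x (n + 1) = duhamel L c N x (picard L c N x n) :=
  Function.iterate_succ_apply' _ _ _

lemma duhamel_terminal (f : ℝ → E) : duhamel L c N x f N = x := by
  rw [duhamel, intervalIntegral.integral_same, add_zero, smul_smul, ← Real.exp_add]
  simp

lemma IsBackwardSol.mono {I I' : Set ℝ} {p : ℝ → E} (hp : IsBackwardSol L I p) (h : I' ⊆ I) :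
    IsBackwardSol L I' p := fun s hs t ht => hp s (h hs) t (h ht)

lemma IsBackwardSol.sub {I : Set ℝ} {p q : ℝ → E} (hp : IsBackwardSol L I p)
    (hq : IsBackwardSol L I q) : IsBackwardSol L I fun s => p s - q s := by
  intro s hs t ht hst
  obtain ⟨h1, h2⟩ := hp s hs t ht hst
  obtain ⟨h3, h4⟩ := hq s hs t ht hst
  simp only [map_sub]
  refine ⟨h1.sub h3, ?_⟩
  rw [intervalIntegral.integral_sub h1 h3, h2, h4]
  abel

lemma IsBackwardSol.continuousOn {a b : ℝ} {p : ℝ → E} (hab : a ≤ b)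
    (hp : IsBackwardSol L (Icc a b) p) : ContinuousOn p (Icc a b) := by
  have hi := (hp a (left_mem_Icc.2 hab) b (right_mem_Icc.2 hab) hab).1
  have h1 := intervalIntegral.continuousOn_primitive_interval' hi.symm left_mem_uIcc
  rw [uIcc_of_ge hab] at h1
  refine (ContinuousOn.fun_sub (continuousOn_const (c := p b)) h1).congr fun s hs => ?_
  rw [(hp s hs b (right_mem_Icc.2 hab) hs.2).2, intervalIntegral.integral_symm]
  exact (sub_eq_add_neg _ _).symm

/-- Feeding a bound into the integrated equation halves it in the weight `exp (2 (C + 1) (N - t))`,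
so the weighted norm is below `R / 2 ^ n` for every `n`. The `C + 1` makes the rate positive even
when `C = 0`. -/
lemma IsBackwardSol.eq_zero (hC : ∀ r, ‖L r‖ ≤ C) {p : ℝ → E} (hp : IsBackwardSol L (Iic N) p)
    (h0 : p N = 0) {s : ℝ} (hs : s ≤ N) : p s = 0 := by
  have hD : 0 < C + 1 := by linarith [(norm_nonneg (L 0)).trans (hC 0)]
  have hcont := (hp.mono (Icc_subset_Iic_self : Icc s N ⊆ _)).continuousOn hs
  obtain ⟨R, hR⟩ := isCompact_Icc.exists_bound_of_continuousOn hcont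
  have hR0 : 0 ≤ R := (norm_nonneg _).trans (hR s (left_mem_Icc.2 hs))
  have key : ∀ n : ℕ, ∀ t ∈ Icc s N,
      ‖p t‖ ≤ R / 2 ^ n * Real.exp (2 * (C + 1) * (N - t)) := by
    intro n
    induction n with
    | zero =>
      intro t ht
      refine (hR t ht).trans ?_
      rw [pow_zero, div_one]
      refine le_mul_of_one_le_right hR0 (Real.one_le_exp ?_)
      exact mul_nonneg (by linarith) (by linarith [ht.2])
    | succ n ih =>
      intro t ht
      rw [(hp t ht.2 N self_mem_Iic ht.2).2, h0, zero_add]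
      refine (norm_integral_le_half_exp (D := C + 1) (K := R / 2 ^ n) (by positivity) ht.2
        ?_).trans_eq ?_
      · intro r hr
        refine ((L r).le_opNorm _).trans ?_
        exact mul_le_mul ((hC r).trans (by linarith)) (ih r ⟨ht.1.trans hr.1, hr.2⟩)
          (norm_nonneg _) hD.le
      · rw [pow_succ]
        ring
  have hlim : Tendsto (fun n : ℕ => R / 2 ^ n * Real.exp (2 * (C + 1) * (N - s))) atTop (𝓝 0) := by
    have := (tendsto_inv_atTop_zero.comp (tendsto_pow_atTop_atTop_of_one_lt
      (one_lt_two : (1 : ℝ) < 2))).const_mul R |>.mul_const (Real.exp (2 * (C + 1) * (N - s)))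
    simpa [div_eq_mul_inv] using this
  have := ge_of_tendsto' hlim fun n => key n s (left_mem_Icc.2 hs)
  exact norm_le_zero_iff.1 this

lemma IsBackwardSol.unique (hC : ∀ r, ‖L r‖ ≤ C) {p q : ℝ → E} (hp : IsBackwardSol L (Iic N) p)
    (hq : IsBackwardSol L (Iic N) q) (h : p N = q N) {s : ℝ} (hs : s ≤ N) : p s = q s :=
  sub_eq_zero.1 ((hp.sub hq).eq_zero hC (sub_eq_zero.2 h) hs)

section Measurable

variable [SecondCountableTopology E]

lemma intervalIntegrable_clm_apply (hL : ∀ x, StronglyMeasurable fun r => L r x)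
    (hC : ∀ r, ‖L r‖ ≤ C) {f : ℝ → E} {a b R : ℝ}
    (hf : AEStronglyMeasurable f (volume.restrict (uIoc a b))) (hR : ∀ r ∈ uIoc a b, ‖f r‖ ≤ R) :
    IntervalIntegrable (fun r => L r (f r)) volume a b :=
  intervalIntegrable_of_bounded (R := C * R) (aestronglyMeasurable_clm_apply hL hf) fun r hr =>
    ((L r).le_opNorm _).trans (mul_le_mul (hC r) (hR r hr) (norm_nonneg _)
      ((norm_nonneg _).trans (hC r)))

lemma intervalIntegrable_duhamelIntegrand (hL : ∀ x, StronglyMeasurable fun r => L r x)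
    (hC : ∀ r, ‖L r‖ ≤ C) {f : ℝ → E} {a b R : ℝ}
    (hf : AEStronglyMeasurable f (volume.restrict (uIoc a b))) (hR : ∀ r ∈ uIoc a b, ‖f r‖ ≤ R) :
    IntervalIntegrable (duhamelIntegrand L c f) volume a b := by
  refine ((intervalIntegrable_clm_apply hL hC hf hR).add
    ((intervalIntegrable_of_bounded hf hR).smul c)).continuousOn_smul ?_
  fun_prop

lemma intervalIntegrable_duhamelIntegrand_of_continuous
    (hL : ∀ x, StronglyMeasurable fun r => L r x)
    (hC : ∀ r, ‖L r‖ ≤ C) {f : ℝ → E} (hf : Continuous f) (a b : ℝ) :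
    IntervalIntegrable (duhamelIntegrand L c f) volume a b := by
  obtain ⟨R, hR⟩ := (isCompact_uIcc (a := a) (b := b)).exists_bound_of_continuousOn
    hf.continuousOn
  exact intervalIntegrable_duhamelIntegrand hL hC hf.aestronglyMeasurable
    fun r hr => hR r (uIoc_subset_uIcc hr)

lemma continuous_duhamel (hL : ∀ x, StronglyMeasurable fun r => L r x)
    (hC : ∀ r, ‖L r‖ ≤ C) {f : ℝ → E} (hf : Continuous f) : Continuous (duhamel L c N x f) := by
  have h : Continuous fun s => ∫ r in s..N, duhamelIntegrand L c f r := by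
    simp_rw [fun s => intervalIntegral.integral_symm (μ := volume)
      (f := duhamelIntegrand L c f) N s]
    exact (intervalIntegral.continuous_primitive
      (fun a b => intervalIntegrable_duhamelIntegrand_of_continuous hL hC hf a b) N).neg
  unfold duhamel
  fun_prop

lemma continuous_picard (hL : ∀ x, StronglyMeasurable fun r => L r x)
    (hC : ∀ r, ‖L r‖ ≤ C) (n : ℕ) : Continuous (picard L c N x n) := by
  induction n with
  | zero => exact continuous_const
  | succ n ih =>
    rw [picard_succ]
    exact continuous_duhamel hL hC ih

/-- The weight has rate twice the Lipschitz constant `C + c` of the shifted generator, and `exp (c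
(s - r)) ≤ 1`. Hence the Duhamel operator contracts by one half on intervals of any length. -/
lemma norm_duhamel_sub_le (hL : ∀ x, StronglyMeasurable fun r => L r x)
    (hC : ∀ r, ‖L r‖ ≤ C) (hc : 0 < c) {f g : ℝ → E} (hf : Continuous f) (hg : Continuous g)
    {K s : ℝ} (hK : 0 ≤ K) (hs : s ≤ N)
    (h : ∀ r ∈ Icc s N, ‖f r - g r‖ ≤ K * Real.exp (2 * (C + c) * (N - r))) :
    ‖duhamel L c N x f s - duhamel L c N x g s‖ ≤ K / 2 * Real.exp (2 * (C + c) * (N - s)) := by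
  have hC0 : 0 ≤ C := (norm_nonneg (L 0)).trans (hC 0)
  have e : duhamel L c N x f s - duhamel L c N x g s =
      ∫ r in s..N, Real.exp (c * s) • (duhamelIntegrand L c f r - duhamelIntegrand L c g r) := by
    rw [intervalIntegral.integral_smul, intervalIntegral.integral_sub
      (intervalIntegrable_duhamelIntegrand_of_continuous hL hC hf _ _)
      (intervalIntegrable_duhamelIntegrand_of_continuous hL hC hg _ _), duhamel, duhamel,
      ← smul_sub]
    congr 1
    abel
  rw [e]
  refine norm_integral_le_half_exp hK hs fun r hr => ?_
  have e2 : Real.exp (c * s) • (duhamelIntegrand L c f r - duhamelIntegrand L c g r) =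
      Real.exp (c * (s - r)) • (L r (f r - g r) + c • (f r - g r)) := by
    rw [duhamelIntegrand, duhamelIntegrand, ← smul_sub, smul_smul, ← Real.exp_add, map_sub]
    congr 1
    · congr 1; ring
    · rw [smul_sub]; abel
  rw [e2, norm_smul, Real.norm_eq_abs, Real.abs_exp]
  have h1 : Real.exp (c * (s - r)) ≤ 1 := by
    rw [Real.exp_le_one_iff]
    exact mul_nonpos_of_nonneg_of_nonpos hc.le (by linarith [hr.1])
  have h2 : ‖L r (f r - g r) + c • (f r - g r)‖ ≤ (C + c) * ‖f r - g r‖ := by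
    refine (norm_add_le _ _).trans ?_
    rw [norm_smul, Real.norm_eq_abs, abs_of_pos hc, add_mul]
    gcongr
    exact (L r).le_of_opNorm_le (hC r) _
  calc _ ≤ 1 * ((C + c) * ‖f r - g r‖) := mul_le_mul h1 h2 (norm_nonneg _) zero_le_one
    _ ≤ _ := by
      rw [one_mul]
      exact mul_le_mul_of_nonneg_left (h r hr) (by linarith)

lemma exists_dist_picard_le (hL : ∀ x, StronglyMeasurable fun r => L r x)
    (hC : ∀ r, ‖L r‖ ≤ C) (hc : 0 < c) (s₀ : ℝ) :
    ∃ R, ∀ s ∈ Icc s₀ N, ∀ n,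
      dist (picard L c N x n s) (picard L c N x (n + 1) s) ≤ R / 2 / 2 ^ n := by
  rcases le_or_gt s₀ N with hs₀ | hs₀
  swap
  · exact ⟨0, fun s hs => absurd (hs.1.trans hs.2) (not_le.2 hs₀)⟩
  have hC0 : 0 ≤ C := (norm_nonneg (L 0)).trans (hC 0)
  obtain ⟨R, hR⟩ := (isCompact_Icc (a := s₀) (b := N)).exists_bound_of_continuousOn
    ((continuous_picard hL hC (c := c) (N := N) (x := x) 1).sub
      (continuous_picard hL hC (c := c) (N := N) (x := x) 0)).continuousOn
  have hR0 : 0 ≤ R := (norm_nonneg _).trans (hR N (right_mem_Icc.2 hs₀))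
  have key : ∀ n : ℕ, ∀ s ∈ Icc s₀ N, ‖picard L c N x (n + 1) s - picard L c N x n s‖ ≤
      R / 2 ^ n * Real.exp (2 * (C + c) * (N - s)) := by
    intro n
    induction n with
    | zero =>
      intro t ht
      refine (hR t ht).trans ?_
      rw [pow_zero, div_one]
      refine le_mul_of_one_le_right hR0 (Real.one_le_exp ?_)
      exact mul_nonneg (by linarith) (by linarith [ht.2])
    | succ n ih =>
      intro t ht
      rw [picard_succ, picard_succ n]
      refine (norm_duhamel_sub_le hL hC hc (continuous_duhamel hL hC (continuous_picard hL hC n))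
        (continuous_picard hL hC n) (K := R / 2 ^ n) (by positivity) ht.2 ?_).trans_eq ?_
      · intro r hr
        rw [← picard_succ]
        exact ih r ⟨ht.1.trans hr.1, hr.2⟩
      · rw [pow_succ]
        ring
  -- The factor `2` matches the form `R / 2 / 2 ^ n` used by the geometric-series lemmas; the weight
  -- is replaced by its maximum, at `s₀`.
  refine ⟨2 * (R * Real.exp (2 * (C + c) * (N - s₀))), fun s hs n => ?_⟩
  rw [dist_comm, dist_eq_norm]
  refine (key n s hs).trans ?_
  have : Real.exp (2 * (C + c) * (N - s)) ≤ Real.exp (2 * (C + c) * (N - s₀)) := by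
    refine Real.exp_le_exp.2 (mul_le_mul_of_nonneg_left ?_ (by linarith))
    linarith [hs.1]
  calc _ ≤ R / 2 ^ n * Real.exp (2 * (C + c) * (N - s₀)) := by gcongr
    _ = _ := by ring

variable [CompleteSpace E]

lemma tendsto_picard (hL : ∀ x, StronglyMeasurable fun r => L r x)
    (hC : ∀ r, ‖L r‖ ≤ C) (hc : 0 < c) {s : ℝ} (hs : s ≤ N) :
    Tendsto (fun n => picard L c N x n s) atTop (𝓝 (evol L c N x s)) := by
  obtain ⟨R, hR⟩ := exists_dist_picard_le (x := x) hL hC hc (N := N) s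
  exact (cauchySeq_of_le_geometric_two (hR s (left_mem_Icc.2 hs))).tendsto_limUnder

lemma exists_norm_picard_le (hL : ∀ x, StronglyMeasurable fun r => L r x)
    (hC : ∀ r, ‖L r‖ ≤ C) (hc : 0 < c) (s₀ : ℝ) :
    ∃ R, ∀ s ∈ Icc s₀ N, ∀ n, ‖picard L c N x n s‖ ≤ R := by
  obtain ⟨R, hR⟩ := exists_dist_picard_le (x := x) hL hC hc (N := N) s₀
  refine ⟨2 * (‖x‖ + R + R), fun s hs n => ?_⟩
  have hR0 : 0 ≤ R := by
    have := dist_nonneg.trans (hR s hs 0)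
    rw [pow_zero, div_one] at this
    linarith
  have h1 : ∀ n, dist (picard L c N x n s) (evol L c N x s) ≤ R := fun n => by
    refine (dist_le_of_le_geometric_two_of_tendsto (hR s hs)
      (tendsto_picard hL hC hc hs.2) n).trans ?_
    exact div_le_self hR0 (one_le_pow₀ one_le_two)
  have h2 : ‖picard L c N x n s - x‖ ≤ R + R := by
    rw [← dist_eq_norm]
    refine (dist_triangle_right _ _ (evol L c N x s)).trans (add_le_add (h1 n) (h1 0))
  have h3 := norm_le_norm_add_norm_sub' (picard L c N x n s) x
  linarith [norm_nonneg x]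

lemma aestronglyMeasurable_evol (hL : ∀ x, StronglyMeasurable fun r => L r x)
    (hC : ∀ r, ‖L r‖ ≤ C) (hc : 0 < c) {s t : ℝ} (hst : s ≤ t) (ht : t ≤ N) :
    AEStronglyMeasurable (evol L c N x) (volume.restrict (uIoc s t)) := by
  refine aestronglyMeasurable_of_tendsto_ae atTop
    (fun n => (continuous_picard (c := c) (N := N) (x := x) hL hC n).aestronglyMeasurable) ?_
  filter_upwards [ae_restrict_mem measurableSet_uIoc] with r hr
  rw [uIoc_of_le hst] at hr
  exact tendsto_picard hL hC hc (hr.2.trans ht)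

lemma duhamel_evol (hL : ∀ x, StronglyMeasurable fun r => L r x)
    (hC : ∀ r, ‖L r‖ ≤ C) (hc : 0 < c) {s : ℝ} (hs : s ≤ N) :
    duhamel L c N x (evol L c N x) s = evol L c N x s := by
  refine tendsto_nhds_unique ?_ (((tendsto_add_atTop_iff_nat 1).2
    (tendsto_picard (x := x) hL hC hc hs)))
  simp_rw [picard_succ]
  unfold duhamel
  refine (tendsto_const_nhds.add ?_).const_smul _
  obtain ⟨R, hR⟩ := exists_norm_picard_le (x := x) hL hC hc (N := N) s
  refine intervalIntegral.tendsto_integral_filter_of_dominated_convergence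
    (fun r => Real.exp (-(c * r)) * (C * R + c * R)) ?_ ?_ ?_ ?_
  · exact Eventually.of_forall fun n => (intervalIntegrable_iff.1
      (intervalIntegrable_duhamelIntegrand_of_continuous hL hC (continuous_picard hL hC n) _ _)).1
  · refine Eventually.of_forall fun n => Eventually.of_forall fun r hr => ?_
    rw [uIoc_of_le hs] at hr
    have hb := hR r ⟨hr.1.le, hr.2⟩ n
    rw [duhamelIntegrand, norm_smul, Real.norm_eq_abs, Real.abs_exp]
    gcongr
    refine (norm_add_le _ _).trans (add_le_add ?_ ?_)
    · exact ((L r).le_opNorm _).trans (mul_le_mul (hC r) hb (norm_nonneg _)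
        ((norm_nonneg _).trans (hC r)))
    · rw [norm_smul, Real.norm_eq_abs, abs_of_pos hc]
      gcongr
  · exact Continuous.intervalIntegrable (by fun_prop) _ _
  · refine Eventually.of_forall fun r hr => ?_
    rw [uIoc_of_le hs] at hr
    have h1 := tendsto_picard (x := x) hL hC hc hr.2
    exact ((((L r).continuous.tendsto _).comp h1).add (h1.const_smul c)).const_smul _

lemma evol_terminal (hL : ∀ x, StronglyMeasurable fun r => L r x)
    (hC : ∀ r, ‖L r‖ ≤ C) (hc : 0 < c) : evol L c N x N = x := by
  rw [← duhamel_evol hL hC hc le_rfl, duhamel_terminal]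

lemma exists_norm_evol_le (hL : ∀ x, StronglyMeasurable fun r => L r x)
    (hC : ∀ r, ‖L r‖ ≤ C) (hc : 0 < c) (s₀ : ℝ) :
    ∃ R, ∀ s ∈ Icc s₀ N, ‖evol L c N x s‖ ≤ R := by
  obtain ⟨R, hR⟩ := exists_norm_picard_le (x := x) hL hC hc (N := N) s₀
  exact ⟨R, fun s hs => le_of_tendsto' (tendsto_picard hL hC hc hs.2).norm (hR s hs)⟩

lemma intervalIntegrable_duhamelIntegrand_evol (hL : ∀ x, StronglyMeasurable fun r => L r x)
    (hC : ∀ r, ‖L r‖ ≤ C) (hc : 0 < c) {s t : ℝ} (hst : s ≤ t) (ht : t ≤ N) :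
    IntervalIntegrable (duhamelIntegrand L c (evol L c N x)) volume s t := by
  obtain ⟨R, hR⟩ := exists_norm_evol_le (x := x) hL hC hc (N := N) s
  refine intervalIntegrable_duhamelIntegrand hL hC (aestronglyMeasurable_evol hL hC hc hst ht)
    (R := R) fun r hr => ?_
  rw [uIoc_of_le hst] at hr
  exact hR r ⟨hr.1.le, hr.2.trans ht⟩

end Measurable

end Evolution

/-! ### From Duhamel to the integrated equation; invariant convex sets; measurability in the
realization. -/

section EvolutionSolution

variable {E : Type*} [NormedAddCommGroup E] [NormedSpace ℝ E]

/-- The product rule for an indefinite integral `y` and a smooth scalar factor `φ`. -/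
lemma smul_eq_add_integral_of_primitive [CompleteSpace E] {y F : ℝ → E} {φ φ' : ℝ → ℝ}
    {a b K B : ℝ} (hab : a ≤ b)
    (hy : ∀ s ∈ Icc a b, ∀ t ∈ Icc a b, s ≤ t → y s = y t + ∫ r in s..t, F r)
    (hF : IntervalIntegrable F volume a b) (hK : ∀ r ∈ Icc a b, ‖F r‖ ≤ K)
    (hφ : ∀ r, HasDerivAt φ (φ' r) r) (hφ' : Continuous φ') (hB : ∀ r ∈ Icc a b, |φ' r| ≤ B) :
    φ a • y a = φ b • y b + ∫ r in a..b, (φ r • F r - φ' r • y r) := by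
  have hφc : Continuous φ := continuous_iff_continuousAt.2 fun r => (hφ r).continuousAt
  have hK0 : 0 ≤ K := (norm_nonneg _).trans (hK a (left_mem_Icc.2 hab))
  have hB0 : 0 ≤ B := (abs_nonneg _).trans (hB a (left_mem_Icc.2 hab))
  have hFi : ∀ s ∈ Icc a b, ∀ t ∈ Icc a b, IntervalIntegrable F volume s t := fun s hs t ht =>
    hF.mono_set (by rw [uIcc_of_le hab]; exact ordConnected_Icc.uIcc_subset hs ht)
  have hyd : ∀ s ∈ Icc a b, ∀ t ∈ Icc a b, s ≤ t → ‖y t - y s‖ ≤ K * (t - s) := by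
    intro s hs t ht hst
    rw [hy s hs t ht hst, sub_add_cancel_left, norm_neg]
    refine (intervalIntegral.norm_integral_le_of_norm_le_const (C := K) fun r hr => ?_).trans_eq
      (by rw [abs_of_nonneg (sub_nonneg.2 hst)])
    rw [uIoc_of_le hst] at hr
    exact hK r ⟨hs.1.trans hr.1.le, hr.2.trans ht.2⟩
  have hyc : ContinuousOn y (Icc a b) := by
    have h1 := intervalIntegral.continuousOn_primitive_interval' hF.symm left_mem_uIcc
    rw [uIcc_of_ge hab] at h1
    refine (ContinuousOn.fun_sub (continuousOn_const (c := y b)) h1).congr fun s hs => ?_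
    rw [hy s hs b (right_mem_Icc.2 hab) hs.2, intervalIntegral.integral_symm]
    exact (sub_eq_add_neg _ _).symm
  have hyi : ∀ s ∈ Icc a b, ∀ t ∈ Icc a b, IntervalIntegrable (fun r => φ' r • y r) volume s t := by
    intro s hs t ht
    refine ContinuousOn.intervalIntegrable (hφ'.continuousOn.smul (hyc.mono ?_))
    exact ordConnected_Icc.uIcc_subset hs ht
  have hφi : ∀ s t, IntervalIntegrable φ' volume s t := fun s t => hφ'.intervalIntegrable _ _
  have hφd : ∀ s t, φ t - φ s = ∫ r in s..t, φ' r := fun s t =>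
    (intervalIntegral.integral_eq_sub_of_hasDerivAt (fun r _ => hφ r) (hφi s t)).symm
  have hφl : ∀ s ∈ Icc a b, ∀ t ∈ Icc a b, s ≤ t → ‖φ t - φ s‖ ≤ B * (t - s) := by
    intro s hs t ht hst
    rw [hφd]
    refine (intervalIntegral.norm_integral_le_of_norm_le_const (C := B) fun r hr => ?_).trans_eq
      (by rw [abs_of_nonneg (sub_nonneg.2 hst)])
    rw [uIoc_of_le hst] at hr
    exact hB r ⟨hs.1.trans hr.1.le, hr.2.trans ht.2⟩
  have hG : ∀ s ∈ Icc a b, ∀ t ∈ Icc a b,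
      IntervalIntegrable (fun r => φ r • F r - φ' r • y r) volume s t := fun s hs t ht =>
    ((hFi s hs t ht).continuousOn_smul hφc.continuousOn).sub (hyi s hs t ht)
  -- As `F` need not be continuous, `y` need not be differentiable everywhere. Instead, the
  -- increment over `[s, t]` of the expected constant is an integral whose integrand is itself `O(t
  -- - s)`.
  have key := eq_of_norm_sub_le_sq (K := 2 * B * K)
    (D := fun s => φ s • y s + ∫ r in a..s, (φ r • F r - φ' r • y r)) hab ?_
  · simp only [intervalIntegral.integral_same, add_zero] at key
    exact key.symm
  intro s hs t ht hst
  have ha := left_mem_Icc.2 hab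
  have e : (φ t • y t + ∫ r in a..t, (φ r • F r - φ' r • y r)) -
      (φ s • y s + ∫ r in a..s, (φ r • F r - φ' r • y r)) =
      ∫ r in s..t, (φ' r • (y t - y r) + (φ r - φ s) • F r) := by
    have h1 : ∫ r in s..t, (φ' r • (y t - y r) + (φ r - φ s) • F r) =
        ∫ r in s..t, ((φ' r • y t - φ s • F r) + (φ r • F r - φ' r • y r)) := by
      congr 1
      ext r
      module
    have hφci : ∀ s t', IntervalIntegrable (fun r => φ' r • y t) volume s t' := fun s t' =>
      Continuous.intervalIntegrable (by fun_prop) _ _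
    have hFsi : IntervalIntegrable (fun r => φ s • F r) volume s t := (hFi s hs t ht).smul _
    rw [h1, intervalIntegral.integral_add ((hφci s t).sub hFsi)
      (hG s hs t ht), intervalIntegral.integral_sub (hφci s t)
      hFsi, intervalIntegral.integral_smul_const,
      intervalIntegral.integral_smul, ← hφd, hy s hs t ht hst,
      ← intervalIntegral.integral_add_adjacent_intervals (hG a ha s hs) (hG s hs t ht)]
    module
  rw [e]
  refine (intervalIntegral.norm_integral_le_of_norm_le_const (C := 2 * B * K * (t - s))
    fun r hr => ?_).trans_eq (by rw [abs_of_nonneg (sub_nonneg.2 hst)]; ring)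
  rw [uIoc_of_le hst] at hr
  have hr' : r ∈ Icc a b := ⟨hs.1.trans hr.1.le, hr.2.trans ht.2⟩
  have h1 : ‖φ' r • (y t - y r)‖ ≤ B * (K * (t - s)) := by
    rw [norm_smul]
    refine mul_le_mul (hB r hr') ((hyd r hr' t ht hr.2).trans ?_) (norm_nonneg _) hB0
    exact mul_le_mul_of_nonneg_left (by linarith [hr.1]) hK0
  have h2 : ‖(φ r - φ s) • F r‖ ≤ B * (t - s) * K := by
    rw [norm_smul]
    refine mul_le_mul ((hφl s hs r hr' hr.1.le).trans ?_) (hK r hr') (norm_nonneg _)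
      (mul_nonneg hB0 (sub_nonneg.2 hst))
    exact mul_le_mul_of_nonneg_left (by linarith [hr.2]) hB0
  refine (norm_add_le _ _).trans ((add_le_add h1 h2).trans_eq ?_)
  ring

variable {L : ℝ → E →L[ℝ] E} {c C N : ℝ} {x : E} [SecondCountableTopology E] [CompleteSpace E]

lemma isBackwardSol_evol (hL : ∀ x, StronglyMeasurable fun r => L r x)
    (hC : ∀ r, ‖L r‖ ≤ C) (hc : 0 < c) : IsBackwardSol L (Iic N) (evol L c N x) := by
  intro a _ b hb hab
  rw [mem_Iic] at hb
  obtain ⟨R, hR⟩ := exists_norm_evol_le (x := x) hL hC hc (N := N) a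
  have hC0 : 0 ≤ C := (norm_nonneg (L 0)).trans (hC 0)
  refine ⟨intervalIntegrable_clm_apply hL hC (aestronglyMeasurable_evol hL hC hc hab hb)
    (R := R) fun r hr => ?_, ?_⟩
  · rw [uIoc_of_le hab] at hr
    exact hR r ⟨hr.1.le, hr.2.trans hb⟩
  set f := evol L c N x with hf
  let y : ℝ → E := fun s => Real.exp (-(c * N)) • x + ∫ r in s..N, duhamelIntegrand L c f r
  have hfy : ∀ s ≤ N, f s = Real.exp (c * s) • y s := fun s hs =>
    (duhamel_evol (x := x) hL hC hc hs).symm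
  have hR0 : 0 ≤ R := (norm_nonneg _).trans (hR a ⟨le_rfl, hab.trans hb⟩)
  -- Undo the shift: `f = exp (c r) • y`, and in the product rule the term `c • f` in the Duhamel
  -- integrand cancels the derivative of the exponential.
  have key := smul_eq_add_integral_of_primitive (y := y) (F := duhamelIntegrand L c f)
    (φ := fun r => Real.exp (c * r)) (φ' := fun r => Real.exp (c * r) * c)
    (K := Real.exp (-(c * a)) * (C * R + c * R)) (B := Real.exp (c * b) * c) hab ?_
    (intervalIntegrable_duhamelIntegrand_evol hL hC hc hab hb) ?_ ?_ (by fun_prop) ?_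
  · rw [hfy a (hab.trans hb), hfy b hb, key]
    congr 1
    refine intervalIntegral.integral_congr fun r hr => ?_
    rw [uIcc_of_le hab] at hr
    simp only [mul_comm _ c, mul_smul]
    rw [← hfy r (hr.2.trans hb), duhamelIntegrand, smul_smul, ← Real.exp_add]
    simp
  · intro s _ t ht hst
    have ht' := ht.2.trans hb
    simp only [y]
    rw [← intervalIntegral.integral_add_adjacent_intervals
      (intervalIntegrable_duhamelIntegrand_evol hL hC hc hst ht')
      (intervalIntegrable_duhamelIntegrand_evol hL hC hc ht' le_rfl)]
    abel
  · intro r hr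
    have hb' := hR r ⟨hr.1, hr.2.trans hb⟩
    rw [duhamelIntegrand, norm_smul, Real.norm_eq_abs, Real.abs_exp]
    refine mul_le_mul (Real.exp_le_exp.2 ?_) ?_ (norm_nonneg _) (Real.exp_pos _).le
    · exact neg_le_neg (mul_le_mul_of_nonneg_left hr.1 hc.le)
    · refine (norm_add_le _ _).trans (add_le_add ?_ ?_)
      · exact ((L r).le_opNorm _).trans (mul_le_mul (hC r) hb' (norm_nonneg _) hC0)
      · rw [norm_smul, Real.norm_eq_abs, abs_of_pos hc]
        gcongr
  · intro r
    have : HasDerivAt (fun r => c * r) (c * 1) r := (hasDerivAt_id r).const_mul c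
    simpa using this.exp
  · intro r hr
    rw [abs_of_nonneg (by positivity)]
    have := mul_le_mul_of_nonneg_left hr.2 hc.le
    gcongr

/-- Scalar form of the Duhamel formula. -/
lemma clm_evol_eq (hL : ∀ x, StronglyMeasurable fun r => L r x)
    (hC : ∀ r, ‖L r‖ ≤ C) (hc : 0 < c) (ℓ : E →L[ℝ] ℝ) {s : ℝ} (hs : s ≤ N) :
    IntervalIntegrable (fun r => Real.exp (-(c * r)) *
        ℓ (L r (evol L c N x r) + c • evol L c N x r)) volume s N ∧
    ℓ (evol L c N x s) = Real.exp (c * s) * (Real.exp (-(c * N)) * ℓ x +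
      ∫ r in s..N, Real.exp (-(c * r)) * ℓ (L r (evol L c N x r) + c • evol L c N x r)) := by
  have hi := intervalIntegrable_duhamelIntegrand_evol (x := x) hL hC hc hs le_rfl
  have e : (fun r => Real.exp (-(c * r)) * ℓ (L r (evol L c N x r) + c • evol L c N x r)) =
      fun r => ℓ (duhamelIntegrand L c (evol L c N x) r) := by
    ext r
    rw [duhamelIntegrand, map_smul, smul_eq_mul]
  rw [e]
  refine ⟨⟨ℓ.integrable_comp hi.1, ℓ.integrable_comp hi.2⟩, ?_⟩
  rw [ContinuousLinearMap.intervalIntegral_comp_comm _ hi]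
  conv_lhs => rw [← duhamel_evol hL hC hc hs, duhamel]
  rw [map_smul, map_add, map_smul, smul_eq_mul, smul_eq_mul]

lemma integral_exp_neg_mul (hc : c ≠ 0) (s : ℝ) :
    ∫ r in s..N, Real.exp (-(c * r)) = (Real.exp (-(c * s)) - Real.exp (-(c * N))) / c := by
  have : ∀ r ∈ uIcc s N,
      HasDerivAt (fun r => -(Real.exp (-(c * r)) / c)) (Real.exp (-(c * r))) r := by
    intro r _
    have h : HasDerivAt (fun r => -(c * r)) (-(c * 1)) r := ((hasDerivAt_id r).const_mul c).neg
    refine (h.exp.div_const c).neg.congr_deriv ?_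
    field_simp
  rw [intervalIntegral.integral_eq_sub_of_hasDerivAt this
    (Continuous.intervalIntegrable (by fun_prop) _ _)]
  ring

/-- A closed convex set that is invariant under all `1 + L(r) / c` is invariant under the
backward evolution. -/
lemma evol_mem (hL : ∀ x, StronglyMeasurable fun r => L r x)
    (hC : ∀ r, ‖L r‖ ≤ C) (hc : 0 < c) {S : Set E} (hS : IsClosed S) (hconv : Convex ℝ S)
    (hx : x ∈ S) (hinv : ∀ r, ∀ y ∈ S, c⁻¹ • (L r y + c • y) ∈ S) {s : ℝ} (hs : s ≤ N) :
    evol L c N x s ∈ S := by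
  -- Duhamel averages `x` with weight `exp (-c (N - s))` and the points `c⁻¹ • (L r (f r) + c • f
  -- r)` of `S` with density `c exp (-c (r - s))`; total weight one. Separating by a functional
  -- reduces the claim to this scalar computation.
  have avg : ∀ f : ℝ → E, Continuous f → (∀ s ≤ N, f s ∈ S) → ∀ s ≤ N, duhamel L c N x f s ∈ S := by
    intro f hf hfS s hs
    by_contra hcon
    obtain ⟨ℓ, u, h1, h2⟩ := geometric_hahn_banach_closed_point hconv hS hcon
    refine h2.not_ge ?_
    have hi := intervalIntegrable_duhamelIntegrand_of_continuous (c := c) hL hC hf s N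
    have hle : ∫ r in s..N, ℓ (duhamelIntegrand L c f r) ≤
        ∫ r in s..N, Real.exp (-(c * r)) * (c * u) := by
      refine intervalIntegral.integral_mono_on hs ⟨ℓ.integrable_comp hi.1, ℓ.integrable_comp hi.2⟩
        (Continuous.intervalIntegrable (by fun_prop) _ _) fun r hr => ?_
      have h3 := (h1 _ (hinv r (f r) (hfS r hr.2))).le
      rw [map_smul, smul_eq_mul, inv_mul_le_iff₀ hc] at h3
      rw [duhamelIntegrand, map_smul, smul_eq_mul]
      exact mul_le_mul_of_nonneg_left h3 (Real.exp_pos _).le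
    rw [intervalIntegral.integral_mul_const, integral_exp_neg_mul hc.ne'] at hle
    rw [duhamel, map_smul, map_add, map_smul, smul_eq_mul, smul_eq_mul,
      ← ContinuousLinearMap.intervalIntegral_comp_comm _ hi]
    have h4 := mul_le_mul_of_nonneg_left (h1 x hx).le (Real.exp_pos (-(c * N))).le
    calc Real.exp (c * s) * (Real.exp (-(c * N)) * ℓ x + ∫ r in s..N, ℓ (duhamelIntegrand L c f r))
        ≤ Real.exp (c * s) * (Real.exp (-(c * N)) * u +
          (Real.exp (-(c * s)) - Real.exp (-(c * N))) / c * (c * u)) := by gcongr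
      _ = (Real.exp (c * s) * Real.exp (-(c * s))) * u := by
        field_simp
        ring
      _ = u := by rw [← Real.exp_add]; simp
  have hpic : ∀ n, ∀ s ≤ N, picard L c N x n s ∈ S := by
    intro n
    induction n with
    | zero => exact fun _ _ => hx
    | succ n ih =>
      rw [picard_succ]
      exact avg _ (continuous_picard hL hC n) ih
  exact hS.mem_of_tendsto (tendsto_picard hL hC hc hs) (Eventually.of_forall fun n => hpic n s hs)

/-- Each Picard iterate is continuous in time and measurable in `ω`, hence jointly measurable, so
integration in time preserves measurability; then pass to the pointwise limit. -/
lemma stronglyMeasurable_evol {Ω : Type*} [MeasurableSpace Ω] {L : Ω → ℝ → E →L[ℝ] E}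
    (hL : ∀ x, StronglyMeasurable fun q : Ω × ℝ => L q.1 q.2 x)
    (hC : ∀ ω r, ‖L ω r‖ ≤ C) (hc : 0 < c) {s : ℝ} (hs : s ≤ N) :
    StronglyMeasurable fun ω => evol (L ω) c N x s := by
  have hLω : ∀ ω x, StronglyMeasurable fun r => L ω r x := fun ω x =>
    (hL x).comp_measurable measurable_prodMk_left
  have hpic : ∀ n s, StronglyMeasurable fun ω => picard (L ω) c N x n s := by
    intro n
    induction n with
    | zero => exact fun s => stronglyMeasurable_const
    | succ n ih =>
      intro s
      simp_rw [picard_succ]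
      have h1 : StronglyMeasurable fun q : Ω × ℝ => picard (L q.1) c N x n q.2 :=
        (stronglyMeasurable_uncurry_of_continuous_of_stronglyMeasurable
          (u := fun (s : ℝ) (ω : Ω) => picard (L ω) c N x n s)
          (fun ω => continuous_picard (hLω ω) (hC ω) n) ih).comp_measurable measurable_swap
      have h2 : StronglyMeasurable fun q : Ω × ℝ =>
          duhamelIntegrand (L q.1) c (picard (L q.1) c N x n) q.2 := by
        refine StronglyMeasurable.smul ?_ ((stronglyMeasurable_clm_apply
          (L := fun q : Ω × ℝ => L q.1 q.2) hL h1).add (h1.const_smul c))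
        exact (by fun_prop : Measurable fun q : Ω × ℝ => Real.exp (-(c * q.2))).stronglyMeasurable
      unfold duhamel
      refine (stronglyMeasurable_const.add ?_).const_smul _
      simp_rw [intervalIntegral]
      exact h2.integral_prod_right'.sub h2.integral_prod_right'
  refine stronglyMeasurable_of_tendsto atTop (fun n => hpic n s) ?_
  rw [tendsto_pi_nhds]
  exact fun ω => tendsto_picard (hLω ω) (hC ω) hc hs

end EvolutionSolution

/-! ### Random walks on the torus with an absolutely continuous step law. -/

section Walk

variable {d : ℕ}

open scoped ENNReal NNReal

instance Torus.isAddHaarMeasure : (volume : Measure (Torus d)).IsAddHaarMeasure := inferInstance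

instance Torus.regular : (volume : Measure (Torus d)).Regular := inferInstance

instance Torus.isNegInvariant : (volume : Measure (Torus d)).IsNegInvariant := inferInstance

lemma toTorus_add (w z : EuclideanSpace ℝ (Fin d)) :
    toTorus (w + z) = toTorus w + toTorus z := by
  ext i
  simp [toTorus]

lemma toTorus_surjective : Function.Surjective (toTorus (d := d)) := by
  intro x
  choose w hw using fun i => QuotientAddGroup.mk_surjective (x i)
  exact ⟨WithLp.toLp 2 w, funext fun i => hw i⟩

/-- Torus translations preserve null sets, so by Fubini almost every `x` has a null set of `z` with
`x + toTorus z` in `s`. Lifting one such `x` to `w` leaves a translation on `ℝ^d`, which is undone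
by invariance. -/
lemma map_toTorus_absolutelyContinuous :
    (volume : Measure (EuclideanSpace ℝ (Fin d))).map toTorus ≪ (volume : Measure (Torus d)) := by
  refine Measure.AbsolutelyContinuous.mk fun s hs h0 => ?_
  rw [Measure.map_apply measurable_toTorus hs]
  have hm : Measurable fun q : Torus d × EuclideanSpace ℝ (Fin d) => q.1 + toTorus q.2 :=
    measurable_fst.add (measurable_toTorus.comp measurable_snd)
  have h1 : ((volume : Measure (Torus d)).prod (volume : Measure (EuclideanSpace ℝ (Fin d))))
      ((fun q => q.1 + toTorus q.2) ⁻¹' s) = 0 := by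
    rw [Measure.prod_apply_symm (hm hs)]
    refine (lintegral_congr fun z => ?_).trans lintegral_zero
    exact ((measurePreserving_add_right (volume : Measure (Torus d)) (toTorus z)).measure_preimage
      hs.nullMeasurableSet).trans h0
  obtain ⟨x, hx⟩ := (Measure.measure_ae_null_of_prod_null h1).exists
  obtain ⟨w, rfl⟩ := toTorus_surjective x
  have h2 : Prod.mk (toTorus w) ⁻¹' ((fun q : Torus d × EuclideanSpace ℝ (Fin d) =>
      q.1 + toTorus q.2) ⁻¹' s) = (fun z => w + z) ⁻¹' (toTorus ⁻¹' s) := by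
    ext z
    simp [toTorus_add]
  replace hx : volume ((fun z => w + z) ⁻¹' (toTorus ⁻¹' s)) = 0 := h2 ▸ hx
  exact ((measurePreserving_add_left volume w).measure_preimage
    (measurable_toTorus hs).nullMeasurableSet).symm.trans hx

/-- The law on the torus of a single jump. -/
def torusLaw (a : EuclideanSpace ℝ (Fin d) → ℝ) : Measure (Torus d) := (jumpLaw a).map toTorus

lemma isProbabilityMeasure_torusLaw {a : EuclideanSpace ℝ (Fin d) → ℝ} (ha : IsJumpKernel a) :
    IsProbabilityMeasure (torusLaw a) :=
  have := isProbabilityMeasure_jumpLaw ha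
  Measure.isProbabilityMeasure_map measurable_toTorus.aemeasurable

lemma torusLaw_absolutelyContinuous (a : EuclideanSpace ℝ (Fin d) → ℝ) :
    torusLaw a ≪ (volume : Measure (Torus d)) :=
  ((withDensity_absolutelyContinuous _ _).map measurable_toTorus).trans
    map_toTorus_absolutelyContinuous

/-- The transition operator of the random walk with step law `ν`. -/
def walk (ν : Measure (Torus d)) (φ : Torus d → ℝ≥0∞) (ξ : Torus d) : ℝ≥0∞ :=
  ∫⁻ x, φ (ξ - x) ∂ν

lemma measurable_walk (ν : Measure (Torus d)) [SFinite ν] {φ : Torus d → ℝ≥0∞}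
    (hφ : Measurable φ) : Measurable (walk ν φ) :=
  (hφ.comp (measurable_fst.sub measurable_snd)).lintegral_prod_right'

lemma measurable_walk_iterate (ν : Measure (Torus d)) [SFinite ν] {φ : Torus d → ℝ≥0∞}
    (hφ : Measurable φ) (k : ℕ) : Measurable ((walk ν)^[k] φ) := by
  induction k with
  | zero => exact hφ
  | succ k ih =>
    rw [Function.iterate_succ_apply']
    exact measurable_walk ν ih

/-- The `k`-step transition density is at least `κ` for increments in `F`. -/
def WalkMinorized (ν : Measure (Torus d)) (k : ℕ) (κ : ℝ≥0∞) (F : Set (Torus d)) : Prop :=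
  ∀ φ : Torus d → ℝ≥0∞, Measurable φ → ∀ ξ, κ * ∫⁻ x in F, φ (ξ - x) ≤ (walk ν)^[k] φ ξ

lemma lintegral_lintegral_sub {F G : Set (Torus d)} (hG : MeasurableSet G)
    {φ : Torus d → ℝ≥0∞} (hφ : Measurable φ) (ξ : Torus d) :
    ∫⁻ x in F, ∫⁻ y in G, φ (ξ - x - y) =
      ∫⁻ w, volume (F ∩ (fun x => w - x) ⁻¹' G) * φ (ξ - w) := by
  have hpre : MeasurableSet {q : Torus d × Torus d | q.2 - q.1 ∈ G} :=
    (measurable_snd.sub measurable_fst) hG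
  have h1 : ∀ x, ∫⁻ y in G, φ (ξ - x - y) =
      ∫⁻ w, ((fun w => w - x) ⁻¹' G).indicator (fun w => φ (ξ - w)) w := by
    intro x
    rw [← lintegral_indicator hG, ← lintegral_sub_right_eq_self _ x]
    refine lintegral_congr fun w => ?_
    simp only [indicator, mem_preimage]
    rw [sub_sub, add_sub_cancel]
    rfl
  have hm : Measurable fun q : Torus d × Torus d =>
      {q : Torus d × Torus d | q.2 - q.1 ∈ G}.indicator (fun q => φ (ξ - q.2)) q :=
    Measurable.indicator (hφ.comp (measurable_const.sub measurable_snd)) hpre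
  simp_rw [h1]
  rw [lintegral_lintegral_swap hm.aemeasurable]
  refine lintegral_congr fun w => ?_
  have hw : MeasurableSet ((fun x => w - x) ⁻¹' G) := (measurable_const.sub measurable_id) hG
  have h2 : (fun x => ((fun w => w - x) ⁻¹' G).indicator (fun w => φ (ξ - w)) w) =
      ((fun x => w - x) ⁻¹' G).indicator fun _ => φ (ξ - w) := by
    ext x
    simp only [indicator]
    rfl
  rw [h2, lintegral_indicator hw, lintegral_const, Measure.restrict_restrict hw,
    Measure.restrict_apply_univ, mul_comm, inter_comm]

/-- The volume of `F ∩ (w - G)` is the convolution at `w` of the two indicators, so it bounds from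
below the density of the composed increments. -/
lemma WalkMinorized.comp {ν : Measure (Torus d)} [SFinite ν] {k l : ℕ} {κ κ' c : ℝ≥0∞}
    {F G H : Set (Torus d)} (h : WalkMinorized ν k κ F) (h' : WalkMinorized ν l κ' G)
    (hG : MeasurableSet G) (hH : MeasurableSet H)
    (hc : ∀ w ∈ H, c ≤ volume (F ∩ (fun x => w - x) ⁻¹' G)) :
    WalkMinorized ν (k + l) (κ * κ' * c) H := by
  intro φ hφ ξ
  rw [Function.iterate_add_apply]
  refine le_trans ?_ (h _ (measurable_walk_iterate ν hφ l) ξ)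
  rw [mul_assoc, mul_assoc]
  refine mul_le_mul_right ?_ _
  calc κ' * (c * ∫⁻ w in H, φ (ξ - w))
      ≤ κ' * ∫⁻ x in F, ∫⁻ y in G, φ (ξ - x - y) := by
        refine mul_le_mul_right ?_ _
        rw [lintegral_lintegral_sub hG hφ, ← lintegral_const_mul _ (by fun_prop)]
        refine le_trans ?_ (setLIntegral_le_lintegral H _)
        exact setLIntegral_mono' hH fun w hw => mul_le_mul_left (hc w hw) _
    _ = ∫⁻ x in F, κ' * ∫⁻ y in G, φ (ξ - x - y) :=
        (lintegral_const_mul _ (Measurable.lintegral_prod_right'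
          (f := fun q : Torus d × Torus d => φ (ξ - q.1 - q.2)) (by fun_prop))).symm
    _ ≤ ∫⁻ x in F, (walk ν)^[l] φ (ξ - x) := lintegral_mono fun x => h' φ hφ (ξ - x)

lemma exists_walkMinorized_one {ν : Measure (Torus d)} [IsProbabilityMeasure ν]
    (hν : ν ≪ volume) : ∃ (κ : ℝ≥0∞) (F : Set (Torus d)), 0 < κ ∧ MeasurableSet F ∧
      0 < volume F ∧ WalkMinorized ν 1 κ F := by
  have hm := ν.measurable_rnDeriv volume
  have hd := Measure.withDensity_rnDeriv_eq ν volume hν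
  have hpos : ∃ n : ℕ, volume {x | ((n : ℝ≥0∞) + 1)⁻¹ ≤ ν.rnDeriv volume x} ≠ 0 := by
    by_contra! hcon
    have h1 : ν.rnDeriv volume =ᵐ[volume] 0 := by
      have h2 := measure_iUnion_null hcon
      refine measure_mono_null (fun x hx => ?_) h2
      obtain ⟨n, hn⟩ := ENNReal.exists_inv_nat_lt hx
      exact mem_iUnion.2 ⟨n, (ENNReal.inv_le_inv.2 le_self_add).trans hn.le⟩
    have h3 : ν = 0 := by
      rw [← hd, withDensity_congr_ae h1]
      exact withDensity_zero
    exact IsProbabilityMeasure.ne_zero ν h3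
  obtain ⟨n, hn⟩ := hpos
  have hF : MeasurableSet {x | ((n : ℝ≥0∞) + 1)⁻¹ ≤ ν.rnDeriv volume x} :=
    measurableSet_le measurable_const hm
  refine ⟨((n : ℝ≥0∞) + 1)⁻¹, _, ?_, hF, pos_iff_ne_zero.2 hn, fun φ hφ ξ => ?_⟩
  · exact ENNReal.inv_pos.2 (ENNReal.add_ne_top.2 ⟨ENNReal.natCast_ne_top n, ENNReal.one_ne_top⟩)
  · have hφ' : Measurable fun x => φ (ξ - x) := hφ.comp (measurable_const.sub measurable_id)
    rw [Function.iterate_one, walk]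
    conv_rhs => rw [← hd, lintegral_withDensity_eq_lintegral_mul _ hm hφ']
    rw [← lintegral_const_mul _ hφ']
    refine le_trans ?_ (setLIntegral_le_lintegral {x | ((n : ℝ≥0∞) + 1)⁻¹ ≤ ν.rnDeriv volume x} _)
    exact setLIntegral_mono' hF fun x hx => mul_le_mul_left hx _

/-- A quantitative form of the Steinhaus theorem for sums. -/
lemma exists_ball_le_volume_inter {F : Set (Torus d)} (hF : MeasurableSet F) (h0 : 0 < volume F) :
    ∃ (x₀ : Torus d) (r : ℝ) (c : ℝ≥0∞), 0 < r ∧ 0 < c ∧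
      ∀ w ∈ Metric.ball x₀ r, c ≤ volume (F ∩ (fun x => w - x) ⁻¹' F) := by
  -- The integral of this volume over all `x₀` is `volume F ^ 2`, which is positive.
  have hx₀ : ∃ x₀, volume (F ∩ (fun x => x₀ - x) ⁻¹' F) ≠ 0 := by
    by_contra! hcon
    have := lintegral_lintegral_sub (F := F) hF (φ := fun _ => 1) measurable_const 0
    simp [hcon, h0.ne'] at this
  obtain ⟨x₀, hx₀⟩ := hx₀
  have hG : MeasurableSet (F ∩ (fun x => x₀ - x) ⁻¹' F) :=
    hF.inter ((measurable_const.sub measurable_id) hF)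
  obtain ⟨K, hKG, hK, hK0⟩ := hG.exists_lt_isCompact (pos_iff_ne_zero.2 hx₀)
  have hKt : volume K ≠ ∞ := measure_ne_top _ _
  -- With `volume U < 2 * volume K`, a small translate of `K` still lies in `U` and must overlap `K`
  -- by at least `2 * volume K - volume U`.
  obtain ⟨U, hKU, hU, hUlt⟩ := K.exists_isOpen_lt_of_lt (volume K + volume K)
    (ENNReal.lt_add_right hKt hK0.ne')
  obtain ⟨r, hr, hrU⟩ := hK.exists_thickening_subset_open hU hKU
  refine ⟨x₀, r, volume K + volume K - volume U, hr, tsub_pos_of_lt hUlt, fun w hw => ?_⟩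
  set y := w - x₀ with hy
  have hy' : ‖y‖ < r := by rwa [hy, ← dist_eq_norm]
  have hKy : volume ((fun x => x - y) ⁻¹' K) = volume K :=
    (measurePreserving_sub_right volume y).measure_preimage hK.measurableSet.nullMeasurableSet
  have hsub : K ∪ (fun x => x - y) ⁻¹' K ⊆ U := by
    refine union_subset hKU fun x hx => hrU (Metric.mem_thickening_iff.2 ⟨x - y, hx, ?_⟩)
    rwa [dist_eq_norm, sub_sub_cancel]
  have hmK : MeasurableSet ((fun x => x - y) ⁻¹' K) :=
    (measurable_id.sub measurable_const) hK.measurableSet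
  have hle : volume K + volume K ≤ volume U + volume (K ∩ (fun x => x - y) ⁻¹' K) := by
    calc volume K + volume K = volume K + volume ((fun x => x - y) ⁻¹' K) := by rw [hKy]
      _ = _ := (measure_union_add_inter K hmK).symm
      _ ≤ _ := add_le_add_left (measure_mono hsub) _
  refine (tsub_le_iff_left.2 hle).trans (measure_mono fun x hx => ⟨(hKG hx.1).1, ?_⟩)
  have := (hKG hx.2).2
  have e : w - x = x₀ - (x - y) := by
    rw [hy]
    abel
  exact (congrArg (· ∈ F) e).mpr this

/-- Scale the shortest real representative of `v` by `θ`. This geodesic splitting lets radii add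
when balls are convolved. -/
lemma UnitAddCircle.exists_split (v : UnitAddCircle) {θ : ℝ} (h0 : 0 ≤ θ) (h1 : θ ≤ 1) :
    ∃ y : UnitAddCircle, ‖y‖ ≤ θ * ‖v‖ ∧ ‖v - y‖ ≤ (1 - θ) * ‖v‖ := by
  obtain ⟨x, rfl⟩ := QuotientAddGroup.mk_surjective v
  have hn : ‖(x : UnitAddCircle)‖ = |x - round x| := UnitAddCircle.norm_eq
  have hle : ∀ s : ℝ, ‖(s : UnitAddCircle)‖ ≤ |s| := fun s => by
    rw [UnitAddCircle.norm_eq]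
    simpa using round_le s 0
  refine ⟨((θ * (x - round x) : ℝ) : UnitAddCircle), ?_, ?_⟩
  · refine (hle _).trans_eq ?_
    rw [abs_mul, abs_of_nonneg h0]
    exact congrArg _ hn.symm
  · have e : ((x : ℝ) : UnitAddCircle) - ((θ * (x - round x) : ℝ) : UnitAddCircle) =
        (((1 - θ) * (x - round x) : ℝ) : UnitAddCircle) := by
      have h2 : x - θ * (x - round x) = (1 - θ) * (x - round x) + (round x : ℤ) • (1 : ℝ) := by
        simp only [zsmul_eq_mul]
        ring
      rw [← AddCircle.coe_sub, h2, AddCircle.coe_add, AddCircle.coe_zsmul, AddCircle.coe_period,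
        smul_zero, add_zero]
    refine (congrArg norm e).trans_le ((hle _).trans_eq ?_)
    rw [abs_mul, abs_of_nonneg (sub_nonneg.2 h1)]
    exact congrArg _ hn.symm

lemma Torus.exists_split (v : Torus d) {θ : ℝ} (h0 : 0 ≤ θ) (h1 : θ ≤ 1) :
    ∃ y : Torus d, ‖y‖ ≤ θ * ‖v‖ ∧ ‖v - y‖ ≤ (1 - θ) * ‖v‖ := by
  choose y hy hy' using fun i => UnitAddCircle.exists_split (v i) h0 h1
  refine ⟨y, (pi_norm_le_iff_of_nonneg (by positivity)).2 fun i => (hy i).trans ?_,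
    (pi_norm_le_iff_of_nonneg (mul_nonneg (sub_nonneg.2 h1) (norm_nonneg _))).2 fun i =>
      (hy' i).trans ?_⟩
  · exact mul_le_mul_of_nonneg_left (norm_le_pi_norm v i) h0
  · exact mul_le_mul_of_nonneg_left (norm_le_pi_norm v i) (sub_nonneg.2 h1)

/-- Cutting `w - (x₀ + y₀)` into pieces of length at most `3r/4` and `R - r/4` leaves room `r/4` in
both balls. The gain of only `r/2` in radius pays for an overlap independent of `R`. -/
lemma volume_ball_inter_ge {x₀ y₀ w : Torus d} {r R : ℝ} (hr : 0 < r) (hR : r ≤ R)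
    (hw : w ∈ Metric.ball (x₀ + y₀) (R + r / 2)) :
    volume (Metric.ball (0 : Torus d) (r / 4)) ≤
      volume (Metric.ball x₀ r ∩ (fun x => w - x) ⁻¹' Metric.ball y₀ R) := by
  have hpos : 0 < R + r / 2 := by linarith
  obtain ⟨y, hy, hy'⟩ := Torus.exists_split (w - (x₀ + y₀)) (θ := 3 * r / 4 / (R + r / 2))
    (by positivity) (by rw [div_le_one hpos]; linarith)
  rw [Metric.mem_ball, dist_eq_norm] at hw
  have h1 : ‖y‖ ≤ 3 * r / 4 := by
    refine hy.trans ((mul_le_mul_of_nonneg_left hw.le (by positivity)).trans_eq ?_)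
    exact div_mul_cancel₀ _ hpos.ne'
  have h2 : ‖w - (x₀ + y₀) - y‖ ≤ R - r / 4 := by
    refine hy'.trans ((mul_le_mul_of_nonneg_left hw.le ?_).trans_eq ?_)
    · rw [sub_nonneg, div_le_one hpos]
      linarith
    · rw [sub_mul, div_mul_cancel₀ _ hpos.ne']
      ring
  have h3 : volume (Metric.ball (0 : Torus d) (r / 4)) =
      volume ((fun x => x - (x₀ + y)) ⁻¹' Metric.ball (0 : Torus d) (r / 4)) :=
    ((measurePreserving_sub_right volume (x₀ + y)).measure_preimage
      measurableSet_ball.nullMeasurableSet).symm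
  rw [h3]
  refine measure_mono fun x hx => ?_
  rw [mem_preimage, mem_ball_zero_iff] at hx
  constructor
  · rw [Metric.mem_ball, dist_eq_norm]
    have : x - x₀ = (x - (x₀ + y)) + y := by abel
    rw [this]
    linarith [norm_add_le (x - (x₀ + y)) y]
  · rw [mem_preimage, Metric.mem_ball, dist_eq_norm]
    have : w - x - y₀ = (w - (x₀ + y₀) - y) - (x - (x₀ + y)) := by abel
    rw [this]
    linarith [norm_sub_le (w - (x₀ + y₀) - y) (x - (x₀ + y))]

/-- Some power of an absolutely continuous law on the torus has a density that is bounded below. -/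
lemma exists_walkMinorized_univ {ν : Measure (Torus d)} [IsProbabilityMeasure ν]
    (hν : ν ≪ volume) : ∃ (k : ℕ) (κ : ℝ≥0∞), 0 < κ ∧ ∀ φ : Torus d → ℝ≥0∞, Measurable φ →
      ∀ ξ, κ * ∫⁻ x, φ x ≤ (walk ν)^[k] φ ξ := by
  obtain ⟨κ₁, F, hκ₁, hF, hF0, h1⟩ := exists_walkMinorized_one hν
  obtain ⟨x₀, r, c, hr, hc, hball⟩ := exists_ball_le_volume_inter hF hF0
  have h2 := h1.comp h1 hF measurableSet_ball hball
  -- Each further pair of steps enlarges the ball by `r/2`; after finitely many pairs it covers the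
  -- torus, whose sup-norm is at most `1/2`.
  have key : ∀ n : ℕ, ∃ (k : ℕ) (κ : ℝ≥0∞) (y : Torus d), 0 < κ ∧
      WalkMinorized ν k κ (Metric.ball y (r + n * (r / 2))) := by
    intro n
    induction n with
    | zero =>
      refine ⟨_, _, x₀, ?_, by simpa using h2⟩
      exact ENNReal.mul_pos (ENNReal.mul_pos hκ₁.ne' hκ₁.ne').ne' hc.ne'
    | succ n ih =>
      obtain ⟨k, κ, y, hκ, h⟩ := ih
      refine ⟨_, _, x₀ + y, ?_, h2.comp (c := volume (Metric.ball (0 : Torus d) (r / 4)))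
        h measurableSet_ball measurableSet_ball fun w hw => ?_⟩
      · refine ENNReal.mul_pos (ENNReal.mul_pos (ENNReal.mul_pos
          (ENNReal.mul_pos hκ₁.ne' hκ₁.ne').ne' hc.ne').ne' hκ.ne').ne' ?_
        exact (Metric.measure_ball_pos _ _ (by positivity)).ne'
      · refine volume_ball_inter_ge hr (le_add_of_nonneg_right (by positivity)) ?_
        convert hw using 2
        push_cast
        ring
  obtain ⟨n, hn⟩ := exists_nat_gt (1 / (r / 2))
  obtain ⟨k, κ, y, hκ, h⟩ := key n
  refine ⟨k, κ, hκ, fun φ hφ ξ => ?_⟩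
  have huniv : Metric.ball y (r + n * (r / 2)) = univ := by
    refine eq_univ_of_forall fun x => ?_
    rw [Metric.mem_ball, dist_eq_norm]
    have h3 : ‖x - y‖ ≤ 1 / 2 := by
      refine (pi_norm_le_iff_of_nonneg (by norm_num)).2 fun i => ?_
      simpa using AddCircle.norm_le_half_period (1 : ℝ) one_ne_zero (x := (x - y) i)
    rw [div_lt_iff₀ (by positivity)] at hn
    linarith
  have := h φ hφ ξ
  rwa [huniv, Measure.restrict_univ, lintegral_sub_left_eq_self] at this

/-- The form of an absolutely continuous walk is bounded by masses, up to a small multiple of the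
supremum. -/
lemma exists_lintegral_mul_walk_le {ν : Measure (Torus d)} [IsProbabilityMeasure ν]
    (hν : ν ≪ volume) {ε : ℝ≥0∞} (hε : 0 < ε) : ∃ K : ℝ≥0, ∀ (φ g : Torus d → ℝ≥0∞) (b : ℝ≥0∞),
      Measurable φ → Measurable g → (∀ᵐ ξ, g ξ ≤ b) →
      ∫⁻ ξ, g ξ * walk ν φ ξ ≤ K * (∫⁻ x, φ x) * (∫⁻ x, g x) + ε * b * ∫⁻ x, φ x := by
  have hm := ν.measurable_rnDeriv volume
  have hd := Measure.withDensity_rnDeriv_eq ν volume hν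
  have hfin : ∫⁻ x, ν.rnDeriv volume x ≠ ∞ := (Measure.lintegral_rnDeriv_lt_top ν volume).ne
  -- The density is merely integrable; truncated subtraction isolates its part above level `n`,
  -- whose `L¹` norm becomes less than `ε`. The bounded part gives the product of masses.
  have hlim : Tendsto (fun n : ℕ => ∫⁻ x, (ν.rnDeriv volume x - n)) atTop (𝓝 0) := by
    have := tendsto_lintegral_of_dominated_convergence (μ := (volume : Measure (Torus d)))
      (F := fun (n : ℕ) x => ν.rnDeriv volume x - n) (f := fun _ => 0) (ν.rnDeriv volume)
      (fun n => hm.sub_const _) (fun n => Eventually.of_forall fun x => tsub_le_self) hfin ?_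
    · simpa using this
    · filter_upwards [ae_lt_top hm hfin] with x hx
      obtain ⟨n, hn⟩ := ENNReal.exists_nat_gt hx.ne
      refine tendsto_const_nhds.congr' ?_
      filter_upwards [eventually_ge_atTop n] with k hk
      exact (tsub_eq_zero_of_le (hn.le.trans (by exact_mod_cast hk))).symm
  obtain ⟨n, hn⟩ := (hlim.eventually (gt_mem_nhds hε)).exists
  refine ⟨n, fun φ g b hφ hg hgb => ?_⟩
  set ρ : Torus d → ℝ≥0∞ := fun x => ν.rnDeriv volume x - n with hρ
  have hρm : Measurable ρ := hm.sub_const _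
  have h1 : ∀ ξ, walk ν φ ξ ≤ n * (∫⁻ x, φ x) + ∫⁻ x, ρ x * φ (ξ - x) := by
    intro ξ
    have hφ' : Measurable fun x => φ (ξ - x) := hφ.comp (measurable_const.sub measurable_id)
    rw [walk]
    conv_lhs => rw [← hd, lintegral_withDensity_eq_lintegral_mul _ hm hφ']
    rw [← lintegral_sub_left_eq_self (μ := volume) φ ξ, ← lintegral_const_mul _ hφ',
      ← lintegral_add_left (hφ'.const_mul _)]
    refine lintegral_mono fun x => ?_
    rw [Pi.mul_apply, ← add_mul]
    exact mul_le_mul_left le_add_tsub _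
  have h2 : ∫⁻ ξ, ∫⁻ x, ρ x * φ (ξ - x) = (∫⁻ x, ρ x) * ∫⁻ x, φ x := by
    rw [lintegral_lintegral_swap (by fun_prop), ← lintegral_mul_const _ hρm]
    refine lintegral_congr fun x => ?_
    rw [lintegral_const_mul _ (by fun_prop), lintegral_sub_right_eq_self]
  calc ∫⁻ ξ, g ξ * walk ν φ ξ
      ≤ ∫⁻ ξ, (n * (∫⁻ x, φ x) * g ξ + b * ∫⁻ x, ρ x * φ (ξ - x)) := by
        refine lintegral_mono_ae ?_
        filter_upwards [hgb] with ξ hξ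
        refine (mul_le_mul_right (h1 ξ) _).trans ?_
        rw [mul_add, mul_comm (g ξ)]
        exact add_le_add_right (mul_le_mul_left hξ _) _
    _ = n * (∫⁻ x, φ x) * (∫⁻ x, g x) + b * ((∫⁻ x, ρ x) * ∫⁻ x, φ x) := by
        rw [lintegral_add_left (hg.const_mul _), lintegral_const_mul _ hg,
          lintegral_const_mul _ (Measurable.lintegral_prod_right'
            (f := fun q : Torus d × Torus d => ρ q.2 * φ (q.1 - q.2)) (by fun_prop)), h2]
    _ ≤ _ := by
        push_cast
        refine add_le_add_right ?_ _
        rw [← mul_assoc, mul_comm b]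
        gcongr

end Walk

/-! ### Weak measurability implies strong measurability in a separable Hilbert space. -/

section WeakMeasurability

/-- A closed ball is cut out by the Cauchy–Schwarz inequalities for a dense sequence of vectors, and
each open set is a countable union of closed balls. -/
lemma stronglyMeasurable_of_inner {H : Type*} [NormedAddCommGroup H] [InnerProductSpace ℝ H]
    [SecondCountableTopology H] {α : Type*} [MeasurableSpace α] {f : α → H}
    (hf : ∀ v, Measurable fun r => inner ℝ v (f r)) : StronglyMeasurable f := by
  borelize H
  refine Measurable.stronglyMeasurable ?_
  have hball : ∀ (x : H) (ρ : ℝ), 0 ≤ ρ → MeasurableSet (f ⁻¹' Metric.closedBall x ρ) := by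
    intro x ρ hρ
    have e : f ⁻¹' Metric.closedBall x ρ = ⋂ n, {r | inner ℝ (TopologicalSpace.denseSeq H n) (f r) -
        inner ℝ (TopologicalSpace.denseSeq H n) x ≤ ρ * ‖TopologicalSpace.denseSeq H n‖} := by
      ext r
      simp only [mem_preimage, Metric.mem_closedBall, mem_iInter, mem_ofPred_eq, dist_eq_norm,
        ← inner_sub_right]
      constructor
      · intro h n
        rw [mul_comm]
        exact (real_inner_le_norm _ _).trans (mul_le_mul_of_nonneg_left h (norm_nonneg _))
      · intro h
        have h1 : ∀ v, inner ℝ v (f r - x) ≤ ρ * ‖v‖ := fun v =>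
          (TopologicalSpace.denseRange_denseSeq H).induction_on
            (p := fun v => inner ℝ v (f r - x) ≤ ρ * ‖v‖) v
            (isClosed_le (by fun_prop) (by fun_prop)) h
        have h2 := h1 (f r - x)
        rw [real_inner_self_eq_norm_sq] at h2
        by_contra! hlt
        nlinarith
    rw [e]
    exact MeasurableSet.iInter fun n => measurableSet_le ((hf _).sub_const _) measurable_const
  refine measurable_of_isOpen fun U hU => ?_
  have e : U = ⋃ q : {q : ℕ × ℕ // Metric.closedBall (TopologicalSpace.denseSeq H q.1)
      (1 / ((q.2 : ℝ) + 1)) ⊆ U},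
      Metric.closedBall (TopologicalSpace.denseSeq H q.1.1) (1 / ((q.1.2 : ℝ) + 1)) := by
    refine Subset.antisymm (fun y hy => ?_) (iUnion_subset fun q => q.2)
    obtain ⟨ε, hε, hεU⟩ := Metric.isOpen_iff.1 hU y hy
    obtain ⟨n, hn⟩ := exists_nat_one_div_lt (half_pos hε)
    obtain ⟨k, hk⟩ := (TopologicalSpace.denseRange_denseSeq H).exists_dist_lt y
      (show (0 : ℝ) < 1 / ((n : ℝ) + 1) by positivity)
    refine mem_iUnion.2 ⟨⟨(k, n), fun z hz => hεU ?_⟩, hk.le⟩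
    rw [Metric.mem_ball]
    rw [Metric.mem_closedBall] at hz
    rw [dist_comm] at hk
    linarith [dist_triangle z (TopologicalSpace.denseSeq H k) y]
  rw [e, preimage_iUnion]
  exact MeasurableSet.iUnion fun q => hball _ _ (by positivity)

end WeakMeasurability

/-! ### Order, averaging and the jump operators on `L²(𝕋^d)`. -/

section Torus

variable {d : ℕ}

instance Torus.isProbabilityMeasure : IsProbabilityMeasure (volume : Measure (Torus d)) :=
  ⟨by simp [volume_pi, Measure.pi_univ]⟩

/-- The constant function `1` in `L²(𝕋^d)`. -/
def oneT (d : ℕ) : L2T d := Lp.const 2 volume (1 : ℝ)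

lemma coeFn_oneT : oneT d =ᵐ[volume] fun _ => (1 : ℝ) :=
  Lp.coeFn_const (p := 2) (μ := volume) (1 : ℝ)

lemma inner_oneT (f : L2T d) : inner ℝ (oneT d) f = ∫ ξ, f ξ := by
  rw [L2.inner_def]
  refine integral_congr_ae ?_
  filter_upwards [coeFn_oneT] with ξ h
  simp [h]

lemma oneT_nonneg : 0 ≤ oneT d := by
  rw [← Lp.coeFn_nonneg]
  filter_upwards [coeFn_oneT] with ξ h
  simp [h]

lemma inner_oneT_oneT : inner ℝ (oneT d) (oneT d) = 1 := by
  rw [inner_oneT, integral_congr_ae coeFn_oneT]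
  simp

instance L2T.secondCountableTopology : SecondCountableTopology (L2T d) := by
  have : Fact ((2 : ENNReal) ≠ ⊤) := ⟨ENNReal.ofNat_ne_top⟩
  infer_instance

lemma inner_nonneg_of_nonneg {f g : L2T d} (hf : 0 ≤ f) (hg : 0 ≤ g) : 0 ≤ inner ℝ f g := by
  rw [L2.inner_def]
  refine integral_nonneg_of_ae ?_
  filter_upwards [(Lp.coeFn_nonneg f).2 hf, (Lp.coeFn_nonneg g).2 hg] with ξ h1 h2
  simpa using mul_nonneg h2 h1

/-- Testing with `|g| - g` gives `‖g‖² ≤ ⟨|g|, g⟩`, which forces `‖|g| - g‖² ≤ 0`. Order statements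
about the adjoint thus reduce to pairings, without a formula for its kernel. -/
lemma nonneg_of_inner_nonneg {g : L2T d} (h : ∀ φ : L2T d, 0 ≤ φ → 0 ≤ inner ℝ φ g) : 0 ≤ g := by
  have h1 := h (|g| - g) (sub_nonneg.2 (le_abs_self g))
  have h2 : ‖|g| - g‖ ^ 2 = 2 * ‖g‖ ^ 2 - 2 * inner ℝ |g| g := by
    rw [norm_sub_sq_real, norm_abs_eq_norm]
    ring
  rw [inner_sub_left, real_inner_self_eq_norm_sq] at h1
  have h3 : ‖|g| - g‖ ^ 2 = 0 := le_antisymm (by linarith) (sq_nonneg _)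
  rw [← sub_eq_zero.1 (norm_eq_zero.1 (pow_eq_zero_iff two_ne_zero |>.1 h3))]
  exact abs_nonneg g

lemma inner_le_inner_right {φ f g : L2T d} (hφ : 0 ≤ φ) (h : f ≤ g) :
    inner ℝ φ f ≤ inner ℝ φ g := by
  have := inner_nonneg_of_nonneg hφ (sub_nonneg.2 h)
  rwa [inner_sub_right, sub_nonneg] at this

lemma inner_le_inner_left {φ f g : L2T d} (hφ : 0 ≤ φ) (h : f ≤ g) :
    inner ℝ f φ ≤ inner ℝ g φ := by
  rw [real_inner_comm φ f, real_inner_comm φ g]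
  exact inner_le_inner_right hφ h

lemma le_of_inner_le {f g : L2T d} (h : ∀ φ : L2T d, 0 ≤ φ → inner ℝ φ f ≤ inner ℝ φ g) :
    f ≤ g := by
  refine sub_nonneg.1 (nonneg_of_inner_nonneg fun φ hφ => ?_)
  rw [inner_sub_right, sub_nonneg]
  exact h φ hφ

lemma smul_oneT_le_iff {f : L2T d} {b : ℝ} : b • oneT d ≤ f ↔ ∀ᵐ ξ, b ≤ f ξ := by
  rw [← Lp.coeFn_le]
  have := Lp.coeFn_smul b (oneT d)
  constructor
  · intro h
    filter_upwards [h, this, coeFn_oneT] with ξ h1 h2 h3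
    simpa [h2, h3] using h1
  · intro h
    filter_upwards [h, this, coeFn_oneT] with ξ h1 h2 h3
    simpa [h2, h3] using h1

lemma le_smul_oneT_iff {f : L2T d} {b : ℝ} : f ≤ b • oneT d ↔ ∀ᵐ ξ, f ξ ≤ b := by
  rw [← Lp.coeFn_le]
  have := Lp.coeFn_smul b (oneT d)
  constructor
  · intro h
    filter_upwards [h, this, coeFn_oneT] with ξ h1 h2 h3
    simpa [h2, h3] using h1
  · intro h
    filter_upwards [h, this, coeFn_oneT] with ξ h1 h2 h3
    simpa [h2, h3] using h1

variable {a : EuclideanSpace ℝ (Fin d) → ℝ} {α₁ α₂ : ℝ} {m : Torus d → Torus d → ℝ}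

lemma coeFn_jumpOp (ha : IsJumpKernel a) (hm : IsCoefficient α₁ α₂ m) (u : L2T d) :
    jumpOp ha hm u =ᵐ[volume] jumpFun a m u :=
  MemLp.coeFn_toLp (memLp_jumpFun ha hm (Lp.memLp u))

lemma norm_jumpOp_le (ha : IsJumpKernel a) (hm : IsCoefficient α₁ α₂ m) :
    ‖jumpOp ha hm‖ ≤ 2 * α₂ :=
  LinearMap.mkContinuous_norm_le _
    (mul_nonneg zero_le_two ((abs_nonneg _).trans (hm.abs_le 0 0))) _

lemma isCoefficient_one : IsCoefficient 1 1 fun _ _ : Torus d => (1 : ℝ) where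
  measurable := measurable_const
  pos := one_pos
  lower _ _ := le_rfl
  upper _ _ := le_rfl

/-- The averaging operator `(J u)(ξ) = ∫ u(ξ - z) a(z) dz`. -/
def jumpAvg (ha : IsJumpKernel a) : L2T d →L[ℝ] L2T d :=
  jumpOp ha isCoefficient_one + ContinuousLinearMap.id ℝ _

lemma ae_integrable_shift (ha : IsJumpKernel a) (u : L2T d) :
    ∀ᵐ ξ, Integrable (fun z => u (ξ - toTorus z)) (jumpLaw a) := by
  have := isProbabilityMeasure_jumpLaw ha
  exact (((Lp.memLp u).comp_measurePreserving
    (measurePreserving_shift (d := d) (jumpLaw a))).integrable (by norm_num)).prod_right_ae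

lemma ae_ae_shift (ha : IsJumpKernel a) {p : Torus d → Prop} (h : ∀ᵐ ξ, p ξ) :
    ∀ᵐ ξ : Torus d, ∀ᵐ z ∂(jumpLaw a), p (ξ - toTorus z) := by
  have := isProbabilityMeasure_jumpLaw ha
  exact Measure.ae_ae_of_ae_prod
    ((measurePreserving_shift (d := d) (jumpLaw a)).quasiMeasurePreserving.ae h)

lemma coeFn_jumpAvg (ha : IsJumpKernel a) (u : L2T d) :
    jumpAvg ha u =ᵐ[volume] fun ξ => ∫ z, u (ξ - toTorus z) ∂(jumpLaw a) := by
  have := isProbabilityMeasure_jumpLaw ha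
  filter_upwards [coeFn_jumpOp ha isCoefficient_one u, ae_integrable_shift ha u,
    Lp.coeFn_add (jumpOp ha isCoefficient_one u) u] with ξ h1 h2 h3
  rw [jumpAvg, add_apply, ContinuousLinearMap.id_apply, h3, Pi.add_apply, h1,
    jumpFun_eq ha]
  simp only [mul_one]
  rw [integral_sub h2 (integrable_const _)]
  simp

lemma jumpAvg_nonneg (ha : IsJumpKernel a) {φ : L2T d} (hφ : 0 ≤ φ) : 0 ≤ jumpAvg ha φ := by
  rw [← Lp.coeFn_nonneg]
  filter_upwards [coeFn_jumpAvg ha φ, ae_ae_shift ha ((Lp.coeFn_nonneg φ).2 hφ)] with ξ h1 h2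
  rw [h1]
  exact integral_nonneg_of_ae h2

/-- The gain term lies between `α₁ J φ` and `α₂ J φ`, and the loss rate between `α₁` and `α₂`. The
leftover `α₂ - α₁`, smaller than `α₂`, is what later closes the upper bound. -/
lemma jumpOp_bounds (ha : IsJumpKernel a) (hm : IsCoefficient α₁ α₂ m) {φ : L2T d} (hφ : 0 ≤ φ) :
    α₁ • jumpAvg ha φ ≤ jumpOp ha hm φ + α₂ • φ ∧
      jumpOp ha hm φ + α₂ • φ ≤ α₂ • jumpAvg ha φ + (α₂ - α₁) • φ := by
  have := isProbabilityMeasure_jumpLaw ha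
  have key : ∀ᵐ ξ, α₁ * jumpAvg ha φ ξ - α₂ * φ ξ ≤ jumpOp ha hm φ ξ ∧
      jumpOp ha hm φ ξ ≤ α₂ * jumpAvg ha φ ξ - α₁ * φ ξ := by
    filter_upwards [coeFn_jumpAvg ha φ, coeFn_jumpOp ha hm φ, ae_integrable_shift ha φ,
      (Lp.coeFn_nonneg φ).2 hφ, ae_ae_shift ha ((Lp.coeFn_nonneg φ).2 hφ)] with ξ h1 h2 h3 h4 h5
    simp only [Pi.zero_apply] at h4 h5
    have hmm : AEStronglyMeasurable (fun z => m ξ (ξ - toTorus z)) (jumpLaw a) :=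
      (hm.measurable.comp (measurable_const.prodMk
        (measurable_const.sub measurable_toTorus))).aestronglyMeasurable
    have hi : Integrable (fun z => m ξ (ξ - toTorus z)) (jumpLaw a) :=
      Integrable.of_bound hmm α₂ (Eventually.of_forall fun z => hm.abs_le _ _)
    have hi' : Integrable (fun z => φ (ξ - toTorus z) * m ξ (ξ - toTorus z)) (jumpLaw a) :=
      h3.mul_bdd (c := α₂) hmm (Eventually.of_forall fun z => hm.abs_le _ _)
    have e : jumpOp ha hm φ ξ = ∫ z, φ (ξ - toTorus z) * m ξ (ξ - toTorus z) ∂(jumpLaw a) -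
        φ ξ * ∫ z, m ξ (ξ - toTorus z) ∂(jumpLaw a) := by
      rw [h2, jumpFun_eq ha, ← integral_const_mul, ← integral_sub hi' (hi.const_mul _)]
      congr 1
      ext z
      ring
    have m1 : α₁ ≤ ∫ z, m ξ (ξ - toTorus z) ∂(jumpLaw a) := by
      simpa using integral_mono (μ := jumpLaw a) (integrable_const α₁) hi fun z => hm.lower _ _
    have m2 : ∫ z, m ξ (ξ - toTorus z) ∂(jumpLaw a) ≤ α₂ := by
      simpa using integral_mono (μ := jumpLaw a) hi (integrable_const α₂) fun z => hm.upper _ _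
    have k1 : α₁ * jumpAvg ha φ ξ ≤ ∫ z, φ (ξ - toTorus z) * m ξ (ξ - toTorus z) ∂(jumpLaw a) := by
      rw [h1, ← integral_const_mul]
      refine integral_mono_ae (h3.const_mul _) hi' ?_
      filter_upwards [h5] with z hz
      rw [mul_comm]
      exact mul_le_mul_of_nonneg_left (hm.lower _ _) hz
    have k2 : ∫ z, φ (ξ - toTorus z) * m ξ (ξ - toTorus z) ∂(jumpLaw a) ≤ α₂ * jumpAvg ha φ ξ := by
      rw [h1, ← integral_const_mul]
      refine integral_mono_ae hi' (h3.const_mul _) ?_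
      filter_upwards [h5] with z hz
      rw [mul_comm α₂]
      exact mul_le_mul_of_nonneg_left (hm.upper _ _) hz
    have m3 := mul_le_mul_of_nonneg_left m1 h4
    have m4 := mul_le_mul_of_nonneg_left m2 h4
    rw [e]
    constructor <;> linarith
  rw [← Lp.coeFn_le, ← Lp.coeFn_le]
  have e1 := Lp.coeFn_add (jumpOp ha hm φ) (α₂ • φ)
  have e2 := Lp.coeFn_smul α₂ φ
  have e3 := Lp.coeFn_smul α₁ (jumpAvg ha φ)
  have e4 := Lp.coeFn_smul α₂ (jumpAvg ha φ)
  have e5 := Lp.coeFn_smul (α₂ - α₁) φ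
  have e6 := Lp.coeFn_add (α₂ • jumpAvg ha φ) ((α₂ - α₁) • φ)
  constructor <;> filter_upwards [key, e1, e2, e3, e4, e5, e6] with ξ hk h1 h2 h3 h4 h5 h6
  · simp only [h1, h2, h3, Pi.add_apply, Pi.smul_apply, smul_eq_mul]
    linarith [hk.1]
  · simp only [h1, h2, h4, h5, h6, Pi.add_apply, Pi.smul_apply, smul_eq_mul]
    linarith [hk.2]

lemma jumpOp_oneT (ha : IsJumpKernel a) (hm : IsCoefficient α₁ α₂ m) :
    jumpOp ha hm (oneT d) = 0 := by
  rw [Lp.eq_zero_iff_ae_eq_zero]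
  refine (coeFn_jumpOp ha hm _).trans ((jumpFun_congr ha m coeFn_oneT).trans ?_)
  refine Eventually.of_forall fun ξ => ?_
  simp [jumpFun]

open scoped ENNReal NNReal

lemma walk_congr {ν : Measure (Torus d)} (hν : ν ≪ volume) {φ ψ : Torus d → ℝ≥0∞}
    (h : φ =ᵐ[volume] ψ) : walk ν φ = walk ν ψ := by
  ext ξ
  refine lintegral_congr_ae (hν.ae_le ?_)
  exact (Measure.measurePreserving_sub_left volume ξ).quasiMeasurePreserving.ae h

lemma ofReal_jumpAvg (ha : IsJumpKernel a) {φ : L2T d} (hφ : 0 ≤ φ) :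
    (fun ξ => ENNReal.ofReal (jumpAvg ha φ ξ)) =ᵐ[volume]
      walk (torusLaw a) fun x => ENNReal.ofReal (φ x) := by
  filter_upwards [coeFn_jumpAvg ha φ, ae_integrable_shift ha φ,
    ae_ae_shift ha ((Lp.coeFn_nonneg φ).2 hφ)] with ξ h1 h2 h3
  rw [h1, ofReal_integral_eq_lintegral_ofReal h2 h3, walk, torusLaw,
    lintegral_map _ measurable_toTorus]
  exact ENNReal.measurable_ofReal.comp
    ((Lp.stronglyMeasurable φ).measurable.comp (measurable_const.sub measurable_id))

lemma jumpAvg_pow_nonneg (ha : IsJumpKernel a) {φ : L2T d} (hφ : 0 ≤ φ) (k : ℕ) :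
    0 ≤ (jumpAvg ha ^ k) φ := by
  induction k with
  | zero => simpa using hφ
  | succ k ih =>
    rw [pow_succ']
    exact jumpAvg_nonneg ha ih

lemma ofReal_jumpAvg_pow (ha : IsJumpKernel a) {φ : L2T d} (hφ : 0 ≤ φ) (k : ℕ) :
    (fun ξ => ENNReal.ofReal ((jumpAvg ha ^ k) φ ξ)) =ᵐ[volume]
      (walk (torusLaw a))^[k] fun x => ENNReal.ofReal (φ x) := by
  induction k with
  | zero => simp
  | succ k ih =>
    rw [pow_succ', Function.iterate_succ_apply',
      ← walk_congr (torusLaw_absolutelyContinuous a) ih]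
    exact ofReal_jumpAvg ha (jumpAvg_pow_nonneg ha hφ k)

lemma measurable_ofReal_coeFn (φ : L2T d) : Measurable fun x => ENNReal.ofReal (φ x) :=
  ENNReal.measurable_ofReal.comp (Lp.stronglyMeasurable φ).measurable

lemma integrable_coeFn (φ : L2T d) : Integrable φ := (Lp.memLp φ).integrable (by norm_num)

lemma lintegral_ofReal_coeFn {φ : L2T d} (hφ : 0 ≤ φ) :
    ∫⁻ x, ENNReal.ofReal (φ x) = ENNReal.ofReal (inner ℝ (oneT d) φ) := by
  rw [inner_oneT, ofReal_integral_eq_lintegral_ofReal (integrable_coeFn φ)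
    ((Lp.coeFn_nonneg φ).2 hφ)]

/-- Doeblin minorization for a power of the averaging operator. -/
lemma exists_smul_oneT_le_jumpAvg_pow (ha : IsJumpKernel a) :
    ∃ (k : ℕ) (κ : ℝ), 0 < κ ∧ ∀ φ : L2T d, 0 ≤ φ →
      (κ * inner ℝ (oneT d) φ) • oneT d ≤ (jumpAvg ha ^ k) φ := by
  have := isProbabilityMeasure_torusLaw ha
  obtain ⟨k, κ, hκ, h⟩ := exists_walkMinorized_univ (torusLaw_absolutelyContinuous a)
  -- The minorization constant may be infinite as an extended real; capping it at `1` makes it a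
  -- real number.
  have hκ' : min κ 1 ≠ ∞ := ne_top_of_le_ne_top ENNReal.one_ne_top (min_le_right _ _)
  refine ⟨k, (min κ 1).toReal, ENNReal.toReal_pos (lt_min hκ one_pos).ne' hκ', fun φ hφ => ?_⟩
  rw [smul_oneT_le_iff]
  filter_upwards [ofReal_jumpAvg_pow ha hφ k,
    (Lp.coeFn_nonneg _).2 (jumpAvg_pow_nonneg ha hφ k)] with ξ h1 h2
  have h3 := h _ (measurable_ofReal_coeFn φ) ξ
  rw [← h1, lintegral_ofReal_coeFn hφ] at h3
  refine (ENNReal.ofReal_le_ofReal_iff h2).1 (le_trans ?_ h3)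
  rw [ENNReal.ofReal_mul ENNReal.toReal_nonneg, ENNReal.ofReal_toReal hκ']
  exact mul_le_mul_left (min_le_left _ _) _

lemma exists_inner_jumpAvg_le (ha : IsJumpKernel a) {ε : ℝ} (hε : 0 < ε) :
    ∃ K : ℝ, 0 ≤ K ∧ ∀ (φ g : L2T d) (b : ℝ), 0 ≤ b → 0 ≤ φ → 0 ≤ g → g ≤ b • oneT d →
      inner ℝ (jumpAvg ha φ) g ≤
        K * inner ℝ (oneT d) φ * inner ℝ (oneT d) g + ε * b * inner ℝ (oneT d) φ := by
  have := isProbabilityMeasure_torusLaw ha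
  obtain ⟨K, hK⟩ := exists_lintegral_mul_walk_le (torusLaw_absolutelyContinuous a)
    (ENNReal.ofReal_pos.2 hε)
  have hK0 : (0 : ℝ) ≤ K := K.2
  refine ⟨K, hK0, fun φ g b hb hφ hg hgb => ?_⟩
  have h1 := hK _ _ (ENNReal.ofReal b) (measurable_ofReal_coeFn φ) (measurable_ofReal_coeFn g) (by
    filter_upwards [le_smul_oneT_iff.1 hgb] with ξ h using ENNReal.ofReal_le_ofReal h)
  have hJ := jumpAvg_nonneg ha hφ
  have e : ∫⁻ ξ, ENNReal.ofReal (g ξ) * walk (torusLaw a) (fun x => ENNReal.ofReal (φ x)) ξ =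
      ENNReal.ofReal (inner ℝ (jumpAvg ha φ) g) := by
    rw [L2.inner_def, ofReal_integral_eq_lintegral_ofReal (L2.integrable_inner _ _)]
    · refine lintegral_congr_ae ?_
      filter_upwards [ofReal_jumpAvg ha hφ, (Lp.coeFn_nonneg g).2 hg] with ξ h2 h3
      rw [← h2, ← ENNReal.ofReal_mul h3]
      simp
    · filter_upwards [(Lp.coeFn_nonneg _).2 hJ, (Lp.coeFn_nonneg g).2 hg] with ξ h2 h3
      simpa using mul_nonneg h3 h2
  have hφ1 := inner_nonneg_of_nonneg (oneT_nonneg (d := d)) hφ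
  have hg1 := inner_nonneg_of_nonneg (oneT_nonneg (d := d)) hg
  rw [e, lintegral_ofReal_coeFn hφ, lintegral_ofReal_coeFn hg, ← ENNReal.ofReal_coe_nnreal,
    ← ENNReal.ofReal_mul hK0, ← ENNReal.ofReal_mul (mul_nonneg hK0 hφ1),
    ← ENNReal.ofReal_mul hε.le, ← ENNReal.ofReal_mul (mul_nonneg hε.le hb),
    ← ENNReal.ofReal_add (mul_nonneg (mul_nonneg hK0 hφ1) hg1)
      (mul_nonneg (mul_nonneg hε.le hb) hφ1)] at h1
  exact (ENNReal.ofReal_le_ofReal_iff (add_nonneg (mul_nonneg (mul_nonneg hK0 hφ1) hg1)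
      (mul_nonneg (mul_nonneg hε.le hb) hφ1))).1 h1

variable {Ω : Type*} [MeasurableSpace Ω] {τ : ℝ → Ω → Ω} {μ : Ω → ℝ → Torus d → Torus d → ℝ}

/-- Pairing with `v` moves the adjoint onto `v`, where the kernel formula gives an iterated integral
of a jointly measurable function. -/
lemma stronglyMeasurable_adjoint_mediumOp (ha : IsJumpKernel a)
    (hμ : IsStationaryMedium τ α₁ α₂ μ) (x : L2T d) :
    StronglyMeasurable fun q : Ω × ℝ =>
      ContinuousLinearMap.adjoint (mediumOp ha hμ q.1 q.2) x := by
  have := isProbabilityMeasure_jumpLaw ha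
  refine stronglyMeasurable_of_inner fun v => ?_
  have e : ∀ q : Ω × ℝ, inner ℝ v (ContinuousLinearMap.adjoint (mediumOp ha hμ q.1 q.2) x) =
      ∫ ξ, (∫ z, (v (ξ - toTorus z) - v ξ) * μ q.1 q.2 ξ (ξ - toTorus z) ∂(jumpLaw a)) * x ξ := by
    intro q
    rw [ContinuousLinearMap.adjoint_inner_right, L2.inner_def]
    refine integral_congr_ae ?_
    filter_upwards [coeFn_jumpOp ha (hμ.isCoefficient q.1 q.2) v] with ξ h
    rw [← jumpFun_eq ha, ← h]
    simp [mediumOp, mul_comm]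
  simp_rw [e]
  have hv := (Lp.stronglyMeasurable v).measurable
  have hx := (Lp.stronglyMeasurable x).measurable
  have hsub : Measurable fun q : ((Ω × ℝ) × Torus d) × EuclideanSpace ℝ (Fin d) =>
      q.1.2 - toTorus q.2 :=
    (measurable_snd.comp measurable_fst).sub (measurable_toTorus.comp measurable_snd)
  have h1 : StronglyMeasurable fun q : ((Ω × ℝ) × Torus d) × EuclideanSpace ℝ (Fin d) =>
      (v (q.1.2 - toTorus q.2) - v q.1.2) * μ q.1.1.1 q.1.1.2 q.1.2 (q.1.2 - toTorus q.2) := by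
    refine Measurable.stronglyMeasurable (((hv.comp hsub).sub
      (hv.comp (measurable_snd.comp measurable_fst))).mul ?_)
    exact hμ.measurable.comp ((measurable_fst.comp (measurable_fst.comp measurable_fst)).prodMk
      ((measurable_snd.comp (measurable_fst.comp measurable_fst)).prodMk
        ((measurable_snd.comp measurable_fst).prodMk hsub)))
  have h2 : StronglyMeasurable fun q : (Ω × ℝ) × Torus d =>
      (∫ z, (v (q.2 - toTorus z) - v q.2) * μ q.1.1 q.1.2 q.2 (q.2 - toTorus z) ∂(jumpLaw a)) *
        x q.2 :=
    h1.integral_prod_right'.mul (hx.comp measurable_snd).stronglyMeasurable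
  exact h2.integral_prod_right'.measurable

end Torus

/-! ### The `L¹` norm on `L²(𝕋^d)`. -/

section MassNorm

variable {d : ℕ}

/-- The `L¹` norm of an element of `L²(𝕋^d)`. -/
def massNorm (f : L2T d) : ℝ := inner ℝ (oneT d) |f|

lemma massNorm_nonneg (f : L2T d) : 0 ≤ massNorm f :=
  inner_nonneg_of_nonneg oneT_nonneg (abs_nonneg f)

lemma continuous_massNorm : Continuous (massNorm (d := d)) := by
  have : Continuous fun f : L2T d => |f| := continuous_id.sup continuous_neg
  unfold massNorm
  fun_prop

lemma massNorm_eq_zero {f : L2T d} (h : massNorm f = 0) : f = 0 := by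
  rw [massNorm, inner_oneT, integral_congr_ae (Lp.coeFn_abs f),
    integral_eq_zero_iff_of_nonneg (fun _ => abs_nonneg _) (integrable_coeFn f).abs] at h
  rw [Lp.eq_zero_iff_ae_eq_zero]
  filter_upwards [h] with ξ hξ
  simpa using hξ

lemma massNorm_sub_le_of_nonneg {f g : L2T d} (hf : 0 ≤ f) (hg : 0 ≤ g) :
    massNorm (f - g) ≤ inner ℝ (oneT d) f + inner ℝ (oneT d) g := by
  rw [massNorm, ← inner_add_right]
  refine inner_le_inner_right oneT_nonneg (sup_le ?_ ?_)
  · exact (sub_le_self _ hg).trans (le_add_of_nonneg_right hg)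
  · rw [neg_sub]
    exact (sub_le_self _ hf).trans (le_add_of_nonneg_left hf)

/-- Interpolation between `L¹` and `L^∞`: it turns the `L¹` contraction into `L²` convergence. -/
lemma norm_sq_le_mul_massNorm {f : L2T d} {b : ℝ} (h : |f| ≤ b • oneT d) :
    ‖f‖ ^ 2 ≤ b * massNorm f := by
  rw [← norm_abs_eq_norm, ← real_inner_self_eq_norm_sq, massNorm, ← real_inner_smul_left]
  exact inner_le_inner_left (abs_nonneg f) h

lemma abs_sub_le_smul_oneT {f g : L2T d} {b : ℝ} (hf : 0 ≤ f) (hg : 0 ≤ g)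
    (hfb : f ≤ b • oneT d) (hgb : g ≤ b • oneT d) : |f - g| ≤ b • oneT d := by
  refine sup_le ((sub_le_self _ hg).trans hfb) ?_
  rw [neg_sub]
  exact (sub_le_self _ hf).trans hgb

end MassNorm

/-! ### The medium: conserved mass, invariant bounds, Doeblin minorization and contraction. -/

section Dynamics

variable {d : ℕ} {a : EuclideanSpace ℝ (Fin d) → ℝ} {α₁ α₂ : ℝ}
  {Ω : Type*} [MeasurableSpace Ω] {τ : ℝ → Ω → Ω} {μ : Ω → ℝ → Torus d → Torus d → ℝ}

/-- The adjoint generators `A_ω(t)^*`. -/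
def mediumAdj (ha : IsJumpKernel a) (hμ : IsStationaryMedium τ α₁ α₂ μ) (ω : Ω) (r : ℝ) :
    L2T d →L[ℝ] L2T d :=
  ContinuousLinearMap.adjoint (mediumOp ha hμ ω r)

/-- The solution of `-∂_t p = A_ω(t)^* p`, `t ≤ N`, with `p = x` at `t = N`. -/
def mediumSol (ha : IsJumpKernel a) (hμ : IsStationaryMedium τ α₁ α₂ μ) (ω : Ω) (N : ℝ)
    (x : L2T d) (s : ℝ) : L2T d :=
  evol (mediumAdj ha hμ ω) α₂ N x s

variable (ha : IsJumpKernel a) (hμ : IsStationaryMedium τ α₁ α₂ μ)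

include hμ in
lemma IsStationaryMedium.le (ω : Ω) : α₁ ≤ α₂ := (hμ.lower ω 0 0 0).trans (hμ.upper ω 0 0 0)

include hμ in
lemma IsStationaryMedium.pos_right (ω : Ω) : 0 < α₂ := hμ.pos.trans_le (hμ.le ω)

lemma stronglyMeasurable_mediumAdj (ω : Ω) (x : L2T d) :
    StronglyMeasurable fun r => mediumAdj ha hμ ω r x := by
  have h := stronglyMeasurable_adjoint_mediumOp ha hμ x
  have hg : Measurable (Prod.mk ω : ℝ → Ω × ℝ) := measurable_prodMk_left
  have h2 := h.comp_measurable hg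
  simp only [Function.comp_def] at h2
  exact h2

lemma norm_mediumAdj_le (ω : Ω) (r : ℝ) : ‖mediumAdj ha hμ ω r‖ ≤ 2 * α₂ := by
  rw [mediumAdj, LinearIsometryEquiv.norm_map]
  exact norm_jumpOp_le ha _

lemma inner_mediumAdj (ω : Ω) (r : ℝ) (φ g : L2T d) :
    inner ℝ φ (mediumAdj ha hμ ω r g + α₂ • g) =
      inner ℝ (mediumOp ha hμ ω r φ + α₂ • φ) g := by
  rw [mediumAdj, inner_add_right, inner_add_left, ContinuousLinearMap.adjoint_inner_right,
    real_inner_smul_left, real_inner_smul_right]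

lemma inner_oneT_mediumAdj (ω : Ω) (r : ℝ) (g : L2T d) :
    inner ℝ (oneT d) (mediumAdj ha hμ ω r g) = 0 := by
  rw [mediumAdj, ContinuousLinearMap.adjoint_inner_right, mediumOp, jumpOp_oneT, inner_zero_left]

lemma inner_mediumAdj_ge (ω : Ω) (r : ℝ) {φ g : L2T d} (hφ : 0 ≤ φ) (hg : 0 ≤ g) :
    α₁ * inner ℝ (jumpAvg ha φ) g ≤ inner ℝ φ (mediumAdj ha hμ ω r g + α₂ • g) := by
  rw [inner_mediumAdj, ← real_inner_smul_left]
  exact inner_le_inner_left hg (jumpOp_bounds ha (hμ.isCoefficient ω r) hφ).1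

lemma inner_mediumAdj_nonneg (ω : Ω) (r : ℝ) {φ g : L2T d} (hφ : 0 ≤ φ) (hg : 0 ≤ g) :
    0 ≤ inner ℝ φ (mediumAdj ha hμ ω r g + α₂ • g) :=
  (mul_nonneg hμ.pos.le (inner_nonneg_of_nonneg (jumpAvg_nonneg ha hφ) hg)).trans
    (inner_mediumAdj_ge ha hμ ω r hφ hg)

lemma isBackwardSol_mediumSol (ω : Ω) (N : ℝ) (x : L2T d) :
    IsBackwardSol (mediumAdj ha hμ ω) (Iic N) (mediumSol ha hμ ω N x) :=
  isBackwardSol_evol (stronglyMeasurable_mediumAdj ha hμ ω) (norm_mediumAdj_le ha hμ ω)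
    (hμ.pos_right ω)

lemma mediumSol_terminal (ω : Ω) (N : ℝ) (x : L2T d) : mediumSol ha hμ ω N x N = x :=
  evol_terminal (stronglyMeasurable_mediumAdj ha hμ ω) (norm_mediumAdj_le ha hμ ω)
    (hμ.pos_right ω)

lemma IsBackwardSol.eq_mediumSol {ω : Ω} {N : ℝ} {p : ℝ → L2T d}
    (hp : IsBackwardSol (mediumAdj ha hμ ω) (Iic N) p) {s : ℝ} (hs : s ≤ N) :
    p s = mediumSol ha hμ ω N (p N) s :=
  hp.unique (norm_mediumAdj_le ha hμ ω) (isBackwardSol_mediumSol ha hμ ω N (p N))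
    (mediumSol_terminal ha hμ ω N (p N)).symm hs

lemma mediumSol_sub (ω : Ω) (N : ℝ) (x y : L2T d) {s : ℝ} (hs : s ≤ N) :
    mediumSol ha hμ ω N (x - y) s = mediumSol ha hμ ω N x s - mediumSol ha hμ ω N y s := by
  have := ((isBackwardSol_mediumSol ha hμ ω N x).sub
    (isBackwardSol_mediumSol ha hμ ω N y)).eq_mediumSol ha hμ hs
  rw [this, mediumSol_terminal, mediumSol_terminal]

/-- Constants are in the kernel of `A`, so the generator contributes nothing to the mass. -/
lemma IsBackwardSol.inner_oneT_eq {ω : Ω} {I : Set ℝ} {p : ℝ → L2T d}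
    (hp : IsBackwardSol (mediumAdj ha hμ ω) I p) {s t : ℝ} (hs : s ∈ I) (ht : t ∈ I)
    (hst : s ≤ t) : inner ℝ (oneT d) (p s) = inner ℝ (oneT d) (p t) := by
  obtain ⟨h1, h2⟩ := hp s hs t ht hst
  have h3 := (innerSL ℝ (oneT d)).intervalIntegral_comp_comm h1
  simp only [innerSL_apply_apply, inner_oneT_mediumAdj, intervalIntegral.integral_zero] at h3
  rw [h2, inner_add_right, ← h3, add_zero]

lemma inner_oneT_mediumSol (ω : Ω) {N s : ℝ} (hs : s ≤ N) (x : L2T d) :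
    inner ℝ (oneT d) (mediumSol ha hμ ω N x s) = inner ℝ (oneT d) x := by
  rw [(isBackwardSol_mediumSol ha hμ ω N x).inner_oneT_eq ha hμ hs self_mem_Iic hs,
    mediumSol_terminal]

lemma convex_setOf_nonneg : Convex ℝ {g : L2T d | 0 ≤ g} := by
  intro f hf g hg s t hs ht _
  refine nonneg_of_inner_nonneg fun φ hφ => ?_
  rw [inner_add_right, real_inner_smul_right, real_inner_smul_right]
  exact add_nonneg (mul_nonneg hs (inner_nonneg_of_nonneg hφ hf))
    (mul_nonneg ht (inner_nonneg_of_nonneg hφ hg))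

lemma mediumAdj_step_nonneg (ω : Ω) (r : ℝ) {g : L2T d} (hg : 0 ≤ g) :
    0 ≤ α₂⁻¹ • (mediumAdj ha hμ ω r g + α₂ • g) := by
  refine nonneg_of_inner_nonneg fun φ hφ => ?_
  rw [real_inner_smul_right]
  exact mul_nonneg (inv_nonneg.2 (hμ.pos_right ω).le) (inner_mediumAdj_nonneg ha hμ ω r hφ hg)

lemma mediumSol_nonneg (ω : Ω) {N s : ℝ} (hs : s ≤ N) {x : L2T d} (hx : 0 ≤ x) :
    0 ≤ mediumSol ha hμ ω N x s :=
  evol_mem (stronglyMeasurable_mediumAdj ha hμ ω) (norm_mediumAdj_le ha hμ ω) (hμ.pos_right ω)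
    (S := {g | 0 ≤ g}) isClosed_Ici convex_setOf_nonneg hx
    (fun r _ hg => mediumAdj_step_nonneg ha hμ ω r hg) hs

/-- A uniform pointwise upper bound for probability densities is preserved. -/
lemma exists_mediumSol_le (ha : IsJumpKernel a) (hμ : IsStationaryMedium τ α₁ α₂ μ) :
    ∃ b : ℝ, 1 ≤ b ∧ ∀ (ω : Ω) (N s : ℝ) (x : L2T d), s ≤ N → 0 ≤ x →
      inner ℝ (oneT d) x = 1 → x ≤ b • oneT d → mediumSol ha hμ ω N x s ≤ b • oneT d := by
  rcases isEmpty_or_nonempty Ω with hΩ | ⟨⟨ω₀⟩⟩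
  · exact ⟨1, le_rfl, fun ω => hΩ.elim ω⟩
  have h1 := hμ.pos
  have h2 := hμ.pos_right ω₀
  have h12 := hμ.le ω₀
  -- With this `ε` the concentrated part of the jump density costs `α₁ b / 2`, and the choice of `b`
  -- makes the bounded part cost at most `α₁ b / 2`. Together with `(α₂ - α₁) b` from the
  -- undisplaced term this is at most `α₂ b`.
  obtain ⟨K, hK0, hK⟩ := exists_inner_jumpAvg_le ha (ε := α₁ / (2 * α₂)) (by positivity)
  set b := max 1 (2 * α₂ * K / α₁) with hb
  have hb1 : 1 ≤ b := le_max_left _ _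
  have hbK : α₂ * K ≤ α₁ * b / 2 := by
    have := le_max_right 1 (2 * α₂ * K / α₁)
    rw [← hb, div_le_iff₀ h1] at this
    linarith
  refine ⟨b, hb1, fun ω N s x hs hx hx1 hxb => ?_⟩
  have hstep : ∀ r, ∀ g : L2T d, 0 ≤ g → inner ℝ (oneT d) g = 1 → g ≤ b • oneT d →
      α₂⁻¹ • (mediumAdj ha hμ ω r g + α₂ • g) ≤ b • oneT d := by
    intro r g hg hg1 hgb
    refine le_of_inner_le fun φ hφ => ?_
    have hI := inner_nonneg_of_nonneg (oneT_nonneg (d := d)) hφ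
    have e1 := inner_le_inner_left hg (jumpOp_bounds ha (hμ.isCoefficient ω r) hφ).2
    have e2 := hK φ g b (by linarith) hφ hg hgb
    have e3 := inner_le_inner_right hφ hgb
    rw [inner_add_left, inner_add_left, real_inner_smul_left, real_inner_smul_left,
      real_inner_smul_left] at e1
    rw [real_inner_smul_right, real_inner_comm (oneT d) φ] at e3
    rw [hg1, mul_one] at e2
    rw [real_inner_smul_right, real_inner_smul_right, inner_mediumAdj, inv_mul_le_iff₀ h2,
      real_inner_comm (oneT d) φ]
    rw [inner_add_left, real_inner_smul_left]
    refine e1.trans ?_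
    have e4 := mul_le_mul_of_nonneg_left e2 h2.le
    have e5 := mul_le_mul_of_nonneg_left e3 (sub_nonneg.2 h12)
    have e6 := mul_le_mul_of_nonneg_right hbK hI
    have e7 : α₂ * (α₁ / (2 * α₂) * b * inner ℝ (oneT d) φ) =
        α₁ * b / 2 * inner ℝ (oneT d) φ := by
      field_simp
    rw [mul_add, e7] at e4
    linarith
  have hmem := evol_mem (stronglyMeasurable_mediumAdj ha hμ ω) (norm_mediumAdj_le ha hμ ω) h2
    (S := {g | 0 ≤ g} ∩ ({g | inner ℝ (oneT d) g = 1} ∩ {g | g ≤ b • oneT d})) (x := x) (N := N)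
    ?_ ?_ ⟨hx, hx1, hxb⟩ ?_ hs
  · exact hmem.2.2
  · exact isClosed_Ici.inter ((isClosed_eq (by fun_prop) continuous_const).inter isClosed_Iic)
  · refine convex_setOf_nonneg.inter ((convex_hyperplane (innerSL ℝ (oneT d)).isLinear 1).inter ?_)
    have : {g : L2T d | g ≤ b • oneT d} = (fun g => b • oneT d - g) ⁻¹' {g | 0 ≤ g} := by
      ext g
      simp
    intro f hf g hg s t hs ht hst
    simp only [this, mem_preimage] at hf hg ⊢
    have e : b • oneT d - (s • f + t • g) = s • (b • oneT d - f) + t • (b • oneT d - g) := by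
      have hB : b • oneT d = s • (b • oneT d) + t • (b • oneT d) := by
        rw [← add_smul, hst, one_smul]
      refine (congrArg (· - (s • f + t • g)) hB).trans ?_
      module
    rw [e]
    exact convex_setOf_nonneg hf hg hs ht hst
  · rintro r g ⟨hg, hg1, hgb⟩
    refine ⟨mediumAdj_step_nonneg ha hμ ω r hg, ?_, hstep r g hg hg1 hgb⟩
    rw [mem_ofPred_eq] at hg1 ⊢
    rw [real_inner_smul_right, inner_add_right, inner_oneT_mediumAdj, real_inner_smul_right, hg1]
    field_simp
    ring

/-- One Duhamel step with the terminal term dropped trades `φ` for `α₁ J φ` under a time integral,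
where the bound for `k` applies; the iterated integrals produce `(N - s)^k / k!`. For `k = 0` the
terminal term is kept and the nonnegative integral is dropped. -/
lemma inner_mediumSol_ge (ω : Ω) (N : ℝ) {x : L2T d} (hx : 0 ≤ x) (k : ℕ) :
    ∀ φ : L2T d, 0 ≤ φ → ∀ s ≤ N,
      Real.exp (α₂ * s) * Real.exp (-(α₂ * N)) *
        (α₁ ^ k * (N - s) ^ k / k.factorial * inner ℝ ((jumpAvg ha ^ k) φ) x) ≤
      inner ℝ φ (mediumSol ha hμ ω N x s) := by
  have hc := hμ.pos_right ω
  have hsol : ∀ r ≤ N, 0 ≤ mediumSol ha hμ ω N x r := fun r hr => mediumSol_nonneg ha hμ ω hr hx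
  have duh : ∀ φ : L2T d, ∀ s ≤ N, _ := fun φ s hs =>
    clm_evol_eq (x := x) (stronglyMeasurable_mediumAdj ha hμ ω) (norm_mediumAdj_le ha hμ ω)
      hc (innerSL ℝ φ) hs
  simp only [innerSL_apply_apply] at duh
  induction k with
  | zero =>
    intro φ hφ s hs
    rw [mediumSol, (duh φ s hs).2]
    have : 0 ≤ ∫ r in s..N, Real.exp (-(α₂ * r)) *
        inner ℝ φ (mediumAdj ha hμ ω r (evol (mediumAdj ha hμ ω) α₂ N x r) +
          α₂ • evol (mediumAdj ha hμ ω) α₂ N x r) :=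
      intervalIntegral.integral_nonneg hs fun r hr => mul_nonneg (Real.exp_pos _).le
        (inner_mediumAdj_nonneg ha hμ ω r hφ (hsol r hr.2))
    simp only [pow_zero, Nat.factorial_zero, Nat.cast_one, mul_one, div_one, one_mul,
      one_apply_eq_self]
    rw [mul_assoc]
    exact mul_le_mul_of_nonneg_left (le_add_of_nonneg_right this) (Real.exp_pos _).le
  | succ k ih =>
    intro φ hφ s hs
    set c₀ := Real.exp (-(α₂ * N)) * (α₁ ^ (k + 1) / k.factorial *
      inner ℝ ((jumpAvg ha ^ (k + 1)) φ) x) with hc₀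
    have h1 : ∫ r in s..N, c₀ * (N - r) ^ k ≤ ∫ r in s..N, Real.exp (-(α₂ * r)) *
        inner ℝ φ (mediumAdj ha hμ ω r (evol (mediumAdj ha hμ ω) α₂ N x r) +
          α₂ • evol (mediumAdj ha hμ ω) α₂ N x r) := by
      refine intervalIntegral.integral_mono_on hs
        (Continuous.intervalIntegrable (by fun_prop) _ _) (duh φ s hs).1 fun r hr => ?_
      have h2 := ih (jumpAvg ha φ) (jumpAvg_nonneg ha hφ) r hr.2
      have h3 := inner_mediumAdj_ge ha hμ ω r hφ (hsol r hr.2)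
      refine le_trans ?_ (mul_le_mul_of_nonneg_left
        ((mul_le_mul_of_nonneg_left h2 hμ.pos.le).trans h3) (Real.exp_pos _).le)
      refine le_of_eq ?_
      have h4 : Real.exp (-(α₂ * r)) * Real.exp (α₂ * r) = 1 := by
        rw [← Real.exp_add]
        simp
      have h5 : (jumpAvg ha ^ k) (jumpAvg ha φ) = (jumpAvg ha ^ (k + 1)) φ := by
        rw [pow_succ]
        rfl
      rw [h5, hc₀]
      linear_combination (-(Real.exp (-(α₂ * N)) * (α₁ ^ (k + 1) / k.factorial *
        inner ℝ ((jumpAvg ha ^ (k + 1)) φ) x) * (N - r) ^ k)) * h4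
    have h6 : ∫ r in s..N, c₀ * (N - r) ^ k = c₀ * ((N - s) ^ (k + 1) / (k + 1)) := by
      rw [intervalIntegral.integral_const_mul,
        intervalIntegral.integral_comp_sub_left (fun r => r ^ k), integral_pow]
      simp
    rw [h6] at h1
    rw [mediumSol, (duh φ s hs).2, mul_assoc]
    refine mul_le_mul_of_nonneg_left ?_ (Real.exp_pos _).le
    have h7 : 0 ≤ Real.exp (-(α₂ * N)) * inner ℝ φ x :=
      mul_nonneg (Real.exp_pos _).le (inner_nonneg_of_nonneg hφ hx)
    refine le_trans (le_of_eq ?_) (h1.trans (le_add_of_nonneg_left h7))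
    rw [hc₀, Nat.factorial_succ]
    push_cast
    field_simp

/-- Doeblin minorization: after unit time a density is bounded below by a fixed fraction of its
mass. -/
lemma exists_doeblin (ha : IsJumpKernel a) (hμ : IsStationaryMedium τ α₁ α₂ μ) :
    ∃ δ : ℝ, 0 < δ ∧ δ < 1 ∧ ∀ (ω : Ω) (s : ℝ) (x : L2T d), 0 ≤ x →
      (δ * inner ℝ (oneT d) x) • oneT d ≤ mediumSol ha hμ ω (s + 1) x s := by
  obtain ⟨k, κ, hκ, h⟩ := exists_smul_oneT_le_jumpAvg_pow ha
  have h1 := hμ.pos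
  -- The second entry comes from elapsed time `1` in the `k`-step bound; the cap `1 / 2` ensures `δ
  -- < 1`.
  refine ⟨min (1 / 2) (Real.exp (-α₂) * (α₁ ^ k / k.factorial * κ)), ?_, ?_, ?_⟩
  · exact lt_min one_half_pos (by positivity)
  · exact lt_of_le_of_lt (min_le_left _ _) one_half_lt_one
  · intro ω s x hx
    refine le_of_inner_le fun φ hφ => ?_
    refine le_trans ?_ (inner_mediumSol_ge ha hμ ω (s + 1) hx k φ hφ s (by linarith))
    have hI := inner_nonneg_of_nonneg (oneT_nonneg (d := d)) hφ
    have hx1 := inner_nonneg_of_nonneg (oneT_nonneg (d := d)) hx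
    have h2 := inner_le_inner_left hx (h φ hφ)
    rw [real_inner_smul_left] at h2
    rw [real_inner_smul_right, real_inner_comm (oneT d) φ]
    have e : Real.exp (α₂ * s) * Real.exp (-(α₂ * (s + 1))) = Real.exp (-α₂) := by
      rw [← Real.exp_add]
      congr 1
      ring
    rw [e, add_sub_cancel_left, one_pow, mul_one]
    calc _ ≤ Real.exp (-α₂) * (α₁ ^ k / k.factorial * κ) * inner ℝ (oneT d) x *
          inner ℝ (oneT d) φ := by
          exact mul_le_mul_of_nonneg_right (mul_le_mul_of_nonneg_right (min_le_right _ _) hx1) hI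
      _ = Real.exp (-α₂) * (α₁ ^ k / k.factorial *
          (κ * inner ℝ (oneT d) φ * inner ℝ (oneT d) x)) := by ring
      _ ≤ _ := by gcongr

/-- Exponential contraction in `L¹` of solutions of zero mean. -/
lemma exists_massNorm_contraction (ha : IsJumpKernel a) (hμ : IsStationaryMedium τ α₁ α₂ μ) :
    ∃ δ : ℝ, 0 < δ ∧ δ < 1 ∧
      (∀ (ω : Ω) (s : ℝ) (x : L2T d), 0 ≤ x →
        (δ * inner ℝ (oneT d) x) • oneT d ≤ mediumSol ha hμ ω (s + 1) x s) ∧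
      ∀ (ω : Ω) (N : ℝ) (p : ℝ → L2T d), IsBackwardSol (mediumAdj ha hμ ω) (Iic N) p →
        inner ℝ (oneT d) (p N) = 0 → ∀ (k : ℕ) (s : ℝ), s + k ≤ N →
          massNorm (p s) ≤ (1 - δ) ^ k * massNorm (p (s + k)) := by
  obtain ⟨δ, hδ, hδ1, h⟩ := exists_doeblin ha hμ
  refine ⟨δ, hδ, hδ1, h, fun ω N p hp h0 k => ?_⟩
  have step : ∀ s, s + 1 ≤ N → massNorm (p s) ≤ (1 - δ) * massNorm (p (s + 1)) := by
    intro s hs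
    set x := p (s + 1) with hx
    have hs1 : s ≤ s + 1 := by linarith
    have hx0 : inner ℝ (oneT d) x = 0 := by
      rw [hx, hp.inner_oneT_eq ha hμ hs self_mem_Iic hs, h0]
    have hps : p s = mediumSol ha hμ ω (s + 1) x⁺ s - mediumSol ha hμ ω (s + 1) x⁻ s := by
      rw [← mediumSol_sub ha hμ ω _ _ _ hs1, posPart_sub_negPart]
      exact (hp.mono (Iic_subset_Iic.2 hs)).eq_mediumSol ha hμ hs1
    -- Zero mean gives both parts the same mass, so both evolutions dominate the same constant.
    -- Subtracting it leaves the difference unchanged and removes the fraction `δ` of the total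
    -- mass.
    have hM : massNorm x = inner ℝ (oneT d) x⁺ + inner ℝ (oneT d) x⁻ := by
      rw [massNorm, ← inner_add_right, posPart_add_negPart]
    have hE : inner ℝ (oneT d) x⁺ - inner ℝ (oneT d) x⁻ = 0 := by
      rw [← inner_sub_right, posPart_sub_negPart, hx0]
    have hu := h ω s x⁺ (posPart_nonneg x)
    have hv := h ω s x⁻ (negPart_nonneg x)
    have hum := inner_oneT_mediumSol ha hμ ω hs1 x⁺
    have hvm := inner_oneT_mediumSol ha hμ ω hs1 x⁻
    rw [← sub_eq_zero.1 hE] at hv hvm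
    set u := mediumSol ha hμ ω (s + 1) x⁺ s
    set v := mediumSol ha hμ ω (s + 1) x⁻ s
    set e := (δ * inner ℝ (oneT d) x⁺) • oneT d with he
    have habs := massNorm_sub_le_of_nonneg (sub_nonneg.2 hu) (sub_nonneg.2 hv)
    rw [sub_sub_sub_cancel_right, inner_sub_right, inner_sub_right, hum, hvm, he,
      real_inner_smul_right, inner_oneT_oneT] at habs
    rw [hps, hM, ← sub_eq_zero.1 hE]
    linarith
  induction k with
  | zero => simp
  | succ k ih =>
    intro s hs
    push_cast at hs ⊢
    have h1 := ih s (by linarith)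
    have h2 := step (s + k) (by linarith)
    rw [add_assoc] at h2
    refine h1.trans ((mul_le_mul_of_nonneg_left h2 (by
      exact pow_nonneg (by linarith) k)).trans_eq ?_)
    ring

end Dynamics

/-! ### The limit of late terminal times and its properties. -/

section Limit

variable {d : ℕ} {a : EuclideanSpace ℝ (Fin d) → ℝ} {α₁ α₂ : ℝ}
  {Ω : Type*} [MeasurableSpace Ω] {τ : ℝ → Ω → Ω} {μ : Ω → ℝ → Torus d → Torus d → ℝ}

/-- The limit `p_∞(·, s)` of the solutions with terminal value `1` at time `N → ∞`. -/
def mediumLim (ha : IsJumpKernel a) (hμ : IsStationaryMedium τ α₁ α₂ μ) (ω : Ω) (s : ℝ) : L2T d :=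
  limUnder atTop fun N => mediumSol ha hμ ω N (oneT d) s

variable (ha : IsJumpKernel a) (hμ : IsStationaryMedium τ α₁ α₂ μ)

lemma oneT_le_smul_oneT {b : ℝ} (hb : 1 ≤ b) : oneT d ≤ b • oneT d := by
  rw [le_smul_oneT_iff]
  filter_upwards [coeFn_oneT] with ξ h
  rwa [h]

/-- Each solution with terminal time `N ≥ s + k` is compared with the one with terminal time `s +
k`. At `s + k` both have mass one, so their `L¹` distance is at most `2`; at `s` it is at most `2 (1
- δ)^k`, and the common bound `b` converts this to `L²`. -/
lemma tendsto_mediumSol (ω : Ω) (s : ℝ) :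
    Tendsto (fun N => mediumSol ha hμ ω N (oneT d) s) atTop (𝓝 (mediumLim ha hμ ω s)) := by
  refine CauchySeq.tendsto_limUnder ?_
  obtain ⟨b, hb, hle⟩ := exists_mediumSol_le ha hμ
  obtain ⟨δ, hδ, hδ1, -, hcontr⟩ := exists_massNorm_contraction ha hμ
  refine Metric.cauchySeq_iff'.2 fun ε hε => ?_
  have hlim : Tendsto (fun k : ℕ => b * ((1 - δ) ^ k * 2)) atTop (𝓝 0) := by
    have := ((tendsto_pow_atTop_nhds_zero_of_lt_one (sub_nonneg.2 hδ1.le)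
      (sub_lt_self 1 hδ)).mul_const 2).const_mul b
    simpa using this
  obtain ⟨k, hk⟩ := (hlim.eventually (gt_mem_nhds (pow_pos hε 2))).exists
  refine ⟨s + k, fun N hN => ?_⟩
  have hsk : s ≤ s + k := le_add_of_nonneg_right k.cast_nonneg
  have hsN := hsk.trans hN
  have hnn : ∀ M r, r ≤ M → 0 ≤ mediumSol ha hμ ω M (oneT d) r := fun M r hr =>
    mediumSol_nonneg ha hμ ω hr oneT_nonneg
  have hup : ∀ M r, r ≤ M → mediumSol ha hμ ω M (oneT d) r ≤ b • oneT d := fun M r hr =>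
    hle ω M r _ hr oneT_nonneg inner_oneT_oneT (oneT_le_smul_oneT hb)
  have hmass : ∀ M r, r ≤ M → inner ℝ (oneT d) (mediumSol ha hμ ω M (oneT d) r) = 1 :=
    fun M r hr => (inner_oneT_mediumSol ha hμ ω hr _).trans inner_oneT_oneT
  have h1 := hcontr ω (s + k) _ (((isBackwardSol_mediumSol ha hμ ω N (oneT d)).mono
    (Iic_subset_Iic.2 hN)).sub (isBackwardSol_mediumSol ha hμ ω (s + k) (oneT d)))
    (by rw [inner_sub_right, hmass _ _ hN, hmass _ _ le_rfl, sub_self]) k s le_rfl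
  have h2 := massNorm_sub_le_of_nonneg (hnn N (s + k) hN) (hnn (s + k) (s + k) le_rfl)
  rw [hmass _ _ hN, hmass _ _ le_rfl] at h2
  have h3 := norm_sq_le_mul_massNorm (abs_sub_le_smul_oneT (hnn N s hsN) (hnn (s + k) s hsk)
    (hup N s hsN) (hup (s + k) s hsk))
  rw [dist_eq_norm]
  refine lt_of_pow_lt_pow_left₀ 2 hε.le (h3.trans_lt (lt_of_le_of_lt ?_ hk))
  refine mul_le_mul_of_nonneg_left (h1.trans (mul_le_mul_of_nonneg_left ?_ ?_)) (by linarith)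
  · linarith
  · exact pow_nonneg (sub_nonneg.2 hδ1.le) k

lemma inner_oneT_mediumLim (ω : Ω) (s : ℝ) : inner ℝ (oneT d) (mediumLim ha hμ ω s) = 1 := by
  refine tendsto_nhds_unique (tendsto_const_nhds.inner (tendsto_mediumSol ha hμ ω s)) ?_
  refine tendsto_const_nhds.congr' ?_
  filter_upwards [eventually_ge_atTop s] with N hN
  rw [inner_oneT_mediumSol ha hμ ω hN, inner_oneT_oneT]

lemma exists_mediumLim_bounds (ha : IsJumpKernel a) (hμ : IsStationaryMedium τ α₁ α₂ μ) :
    ∃ π₁ π₂ : ℝ, 0 < π₁ ∧ ∀ ω s, ∀ᵐ ξ,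
      π₁ ≤ mediumLim ha hμ ω s ξ ∧ mediumLim ha hμ ω s ξ ≤ π₂ := by
  obtain ⟨b, hb, hle⟩ := exists_mediumSol_le ha hμ
  obtain ⟨δ, hδ, -, h⟩ := exists_doeblin ha hμ
  refine ⟨δ, b, hδ, fun ω s => ?_⟩
  have h1 : mediumLim ha hμ ω s ≤ b • oneT d := by
    refine le_of_tendsto (tendsto_mediumSol ha hμ ω s) ?_
    filter_upwards [eventually_ge_atTop s] with N hN
    exact hle ω N s _ hN oneT_nonneg inner_oneT_oneT (oneT_le_smul_oneT hb)
  have h2 : δ • oneT d ≤ mediumLim ha hμ ω s := by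
    refine ge_of_tendsto (tendsto_mediumSol ha hμ ω s) ?_
    filter_upwards [eventually_ge_atTop (s + 1)] with N hN
    have hx := mediumSol_nonneg ha hμ ω hN (oneT_nonneg (d := d))
    have h3 := h ω s _ hx
    rw [inner_oneT_mediumSol ha hμ ω hN, inner_oneT_oneT, mul_one] at h3
    rwa [((isBackwardSol_mediumSol ha hμ ω N (oneT d)).mono
      (Iic_subset_Iic.2 hN)).eq_mediumSol ha hμ (by linarith : s ≤ s + 1)]
  filter_upwards [smul_oneT_le_iff.1 h2, le_smul_oneT_iff.1 h1] with ξ h3 h4 using ⟨h3, h4⟩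

lemma norm_le_of_nonneg_of_le {f : L2T d} {b : ℝ} (hb : 0 ≤ b) (hf : 0 ≤ f)
    (hfb : f ≤ b • oneT d) : ‖f‖ ≤ b := by
  have h1 : ‖f‖ ≤ ‖b • oneT d‖ := norm_le_norm_of_abs_le_abs (by
    rwa [abs_of_nonneg hf, abs_of_nonneg (hf.trans hfb)])
  have h2 : ‖oneT d‖ = 1 := by
    rw [norm_eq_sqrt_real_inner, inner_oneT_oneT, Real.sqrt_one]
  rwa [norm_smul, h2, mul_one, Real.norm_of_nonneg hb] at h1

/-- Dominated convergence in the integrated equation along terminal times `t + n`; the uniform bound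
`b` is the dominating constant. -/
lemma isBackwardSol_mediumLim (ω : Ω) :
    IsBackwardSol (mediumAdj ha hμ ω) univ (mediumLim ha hμ ω) := by
  obtain ⟨b, hb, hle⟩ := exists_mediumSol_le ha hμ
  have hb0 : 0 ≤ b := zero_le_one.trans hb
  have hup : ∀ M r, r ≤ M → ‖mediumSol ha hμ ω M (oneT d) r‖ ≤ b := fun M r hr =>
    norm_le_of_nonneg_of_le hb0 (mediumSol_nonneg ha hμ ω hr oneT_nonneg)
      (hle ω M r _ hr oneT_nonneg inner_oneT_oneT (oneT_le_smul_oneT hb))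
  intro s _ t _ hst
  have hN : Tendsto (fun n : ℕ => t + (n : ℝ)) atTop atTop :=
    tendsto_atTop_add_const_left _ _ tendsto_natCast_atTop_atTop
  have htN : ∀ n : ℕ, t ≤ t + (n : ℝ) := fun n => le_add_of_nonneg_right n.cast_nonneg
  have hlim : ∀ r, Tendsto (fun n : ℕ => mediumSol ha hμ ω (t + n) (oneT d) r) atTop
      (𝓝 (mediumLim ha hμ ω r)) := fun r => (tendsto_mediumSol ha hμ ω r).comp hN
  have hsol := fun n : ℕ => isBackwardSol_mediumSol ha hμ ω (t + n) (oneT d) s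
    (hst.trans (htN n)) t (htN n) hst
  have hbound : ∀ n : ℕ, ∀ r ∈ uIoc s t, ‖mediumSol ha hμ ω (t + n) (oneT d) r‖ ≤ b := by
    intro n r hr
    rw [uIoc_of_le hst] at hr
    exact hup _ _ (hr.2.trans (htN n))
  have hmeas : AEStronglyMeasurable (mediumLim ha hμ ω) (volume.restrict (uIoc s t)) := by
    refine aestronglyMeasurable_of_tendsto_ae atTop (fun n : ℕ => ?_)
      (Eventually.of_forall hlim)
    exact aestronglyMeasurable_evol (stronglyMeasurable_mediumAdj ha hμ ω)
      (norm_mediumAdj_le ha hμ ω) (hμ.pos_right ω) hst (htN n)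
  refine ⟨intervalIntegrable_clm_apply (stronglyMeasurable_mediumAdj ha hμ ω)
    (norm_mediumAdj_le ha hμ ω) hmeas (R := b) fun r hr => ?_, ?_⟩
  · exact le_of_tendsto' (hlim r).norm fun n => hbound n r hr
  · have hint : Tendsto (fun n : ℕ => ∫ r in s..t, mediumAdj ha hμ ω r
        (mediumSol ha hμ ω (t + n) (oneT d) r)) atTop
        (𝓝 (∫ r in s..t, mediumAdj ha hμ ω r (mediumLim ha hμ ω r))) := by
      refine intervalIntegral.tendsto_integral_filter_of_dominated_convergence
        (fun _ => 2 * α₂ * b) ?_ ?_ intervalIntegrable_const ?_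
      · exact Eventually.of_forall fun n => (intervalIntegrable_iff.1 (hsol n).1).1
      · refine Eventually.of_forall fun n => Eventually.of_forall fun r hr => ?_
        refine ((mediumAdj ha hμ ω r).le_opNorm _).trans ?_
        exact mul_le_mul (norm_mediumAdj_le ha hμ ω r) (hbound n r hr) (norm_nonneg _)
          (mul_nonneg zero_le_two (hμ.pos_right ω).le)
      · exact Eventually.of_forall fun r _ =>
          ((mediumAdj ha hμ ω r).continuous.tendsto _).comp (hlim r)
    exact tendsto_nhds_unique (hlim s) (((hlim t).add hint).congr fun n => (hsol n).2.symm)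

lemma continuous_mediumLim (ω : Ω) : Continuous (mediumLim ha hμ ω) := by
  refine continuous_iff_continuousAt.2 fun s => ?_
  have h := ((isBackwardSol_mediumLim ha hμ ω).mono
    (subset_univ (Icc (s - 1) (s + 1)))).continuousOn (by linarith)
  exact h.continuousAt (Icc_mem_nhds (by linarith) (by linarith))

lemma jumpOp_congr {m m' : Torus d → Torus d → ℝ} (h : m = m') (hm : IsCoefficient α₁ α₂ m)
    (hm' : IsCoefficient α₁ α₂ m') : jumpOp ha hm = jumpOp ha hm' := by
  subst h
  rfl

lemma mediumAdj_shift (ω : Ω) (t s : ℝ) :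
    mediumAdj ha hμ (τ s ω) t = mediumAdj ha hμ ω (t + s) :=
  congrArg ContinuousLinearMap.adjoint
    (jumpOp_congr ha (hμ.stationary ω t s).symm (hμ.isCoefficient _ _) (hμ.isCoefficient _ _))

lemma mediumSol_shift (ω : Ω) (N s : ℝ) (x : L2T d) {t : ℝ} (ht : t ≤ N) :
    mediumSol ha hμ ω (N + s) x (t + s) = mediumSol ha hμ (τ s ω) N x t := by
  have h : IsBackwardSol (mediumAdj ha hμ (τ s ω)) (Iic N)
      fun t => mediumSol ha hμ ω (N + s) x (t + s) := by
    intro u hu v hv huv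
    obtain ⟨h1, h2⟩ := isBackwardSol_mediumSol ha hμ ω (N + s) x (u + s)
      (add_le_add_left hu s) (v + s) (add_le_add_left hv s) (add_le_add_left huv s)
    simp_rw [mediumAdj_shift]
    refine ⟨by simpa using h1.comp_add_right s, ?_⟩
    rw [h2, intervalIntegral.integral_comp_add_right
      (fun r => mediumAdj ha hμ ω r (mediumSol ha hμ ω (N + s) x r))]
  have := h.eq_mediumSol ha hμ ht
  rwa [mediumSol_terminal] at this

lemma mediumLim_shift (ω : Ω) (s t : ℝ) :
    mediumLim ha hμ ω (t + s) = mediumLim ha hμ (τ s ω) t := by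
  have h1 := (tendsto_mediumSol ha hμ ω (t + s)).comp (tendsto_atTop_add_const_right _ s tendsto_id)
  refine tendsto_nhds_unique h1 ((tendsto_mediumSol ha hμ (τ s ω) t).congr' ?_)
  filter_upwards [eventually_ge_atTop t] with N hN
  exact (mediumSol_shift ha hμ ω N s _ hN).symm

lemma stronglyMeasurable_mediumLim (s : ℝ) : StronglyMeasurable fun ω => mediumLim ha hμ ω s := by
  rcases isEmpty_or_nonempty Ω with hΩ | ⟨⟨ω₀⟩⟩
  · exact .of_discrete
  have hN : Tendsto (fun n : ℕ => s + (n : ℝ)) atTop atTop :=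
    tendsto_atTop_add_const_left _ _ tendsto_natCast_atTop_atTop
  refine stronglyMeasurable_of_tendsto atTop (f := fun (n : ℕ) ω =>
    mediumSol ha hμ ω (s + n) (oneT d) s) (fun n => ?_) ?_
  · exact stronglyMeasurable_evol (L := mediumAdj ha hμ)
      (stronglyMeasurable_adjoint_mediumOp ha hμ) (norm_mediumAdj_le ha hμ) (hμ.pos_right ω₀)
      (le_add_of_nonneg_right n.cast_nonneg)
  · rw [tendsto_pi_nhds]
    exact fun ω => (tendsto_mediumSol ha hμ ω s).comp hN

end Limit

/-! ### Uniqueness of the normalized stationary solution. -/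

section Uniqueness

open scoped ENNReal

/-- A finite random variable that is dominated by small multiples of copies of itself vanishes. -/
lemma ae_eq_zero_of_le_pow_mul_comp {Ω : Type*} [MeasurableSpace Ω] {P : Measure Ω}
    [IsProbabilityMeasure P] {T : ℕ → Ω → Ω} (hT : ∀ k, MeasurePreserving (T k) P P) {X : Ω → ℝ}
    (hX : AEMeasurable X P) (hX0 : ∀ ω, 0 ≤ X ω) {θ : ℝ} (hθ : 0 ≤ θ) (hθ1 : θ < 1)
    (h : ∀ k, ∀ᵐ ω ∂P, X ω ≤ θ ^ k * X (T k ω)) : ∀ᵐ ω ∂P, X ω = 0 := by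
  -- No moment of `X` is assumed: truncation at `1` makes everything integrable while keeping
  -- monotonicity and the zero set.
  have hm : ∀ k : ℕ, AEMeasurable (fun ω => min (ENNReal.ofReal (θ ^ k * X ω)) 1) P := fun k =>
    ((hX.const_mul _).ennreal_ofReal).min aemeasurable_const
  have hle : ∀ k : ℕ, ∫⁻ ω, min (ENNReal.ofReal (X ω)) 1 ∂P ≤
      ∫⁻ ω, min (ENNReal.ofReal (θ ^ k * X ω)) 1 ∂P := by
    intro k
    have e : ∫⁻ ω, min (ENNReal.ofReal (θ ^ k * X ω)) 1 ∂P =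
        ∫⁻ ω, min (ENNReal.ofReal (θ ^ k * X (T k ω))) 1 ∂P := by
      conv_lhs => rw [← (hT k).map_eq]
      exact lintegral_map' (by rw [(hT k).map_eq]; exact hm k) (hT k).measurable.aemeasurable
    rw [e]
    refine lintegral_mono_ae ?_
    filter_upwards [h k] with ω hω
    exact min_le_min_right _ (ENNReal.ofReal_le_ofReal hω)
  have hlim : Tendsto (fun k : ℕ => ∫⁻ ω, min (ENNReal.ofReal (θ ^ k * X ω)) 1 ∂P) atTop
      (𝓝 (∫⁻ _, 0 ∂P)) := by
    refine tendsto_lintegral_of_dominated_convergence' (fun _ => 1) hm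
      (fun k => Eventually.of_forall fun ω => min_le_right _ _) (by simp)
      (Eventually.of_forall fun ω => ?_)
    have h1 : Tendsto (fun k : ℕ => θ ^ k * X ω) atTop (𝓝 0) := by
      simpa using (tendsto_pow_atTop_nhds_zero_of_lt_one hθ hθ1).mul_const (X ω)
    simpa using (ENNReal.tendsto_ofReal h1).min (tendsto_const_nhds (x := (1 : ℝ≥0∞)))
  rw [lintegral_zero] at hlim
  have hz : ∫⁻ ω, min (ENNReal.ofReal (X ω)) 1 ∂P = 0 :=
    le_antisymm (ge_of_tendsto' hlim hle) zero_le
  have hm0 : AEMeasurable (fun ω => min (ENNReal.ofReal (X ω)) 1) P := by simpa using hm 0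
  filter_upwards [(lintegral_eq_zero_iff' hm0).1 hz] with ω hω
  have h2 : ENNReal.ofReal (X ω) = 0 := by
    by_contra hne
    exact (lt_min (pos_iff_ne_zero.2 hne) one_pos).ne' hω
  exact le_antisymm (ENNReal.ofReal_eq_zero.1 h2) (hX0 ω)

variable {d : ℕ} {a : EuclideanSpace ℝ (Fin d) → ℝ} {α₁ α₂ : ℝ}
  {Ω : Type*} [MeasurableSpace Ω] {τ : ℝ → Ω → Ω} {μ : Ω → ℝ → Torus d → Torus d → ℝ}

lemma IsStationarySolution.ae_eq_mediumLim {P : Measure Ω} [IsProbabilityMeasure P]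
    (ha : IsJumpKernel a) (hτ : ∀ s, MeasurePreserving (τ s) P P)
    (hμ : IsStationaryMedium τ α₁ α₂ μ) {q : Ω → ℝ → L2T d}
    (hq : IsStationarySolution P τ (mediumOp ha hμ) q)
    (hmass : ∀ᵐ ω ∂P, ∀ s, ∫ ξ, q ω s ξ = 1) : ∀ᵐ ω ∂P, ∀ s, q ω s = mediumLim ha hμ ω s := by
  obtain ⟨δ, hδ, hδ1, -, hcontr⟩ := exists_massNorm_contraction ha hμ
  have hmass0 : ∀ᵐ ω ∂P, ∀ s, inner ℝ (oneT d) (q ω s - mediumLim ha hμ ω s) = 0 := by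
    filter_upwards [hmass] with ω hω s
    rw [inner_sub_right, inner_oneT_mediumLim, inner_oneT, hω s, sub_self]
  have hsol : ∀ᵐ ω ∂P, IsBackwardSol (mediumAdj ha hμ ω) univ
      fun s => q ω s - mediumLim ha hμ ω s := by
    filter_upwards [hq.solves] with ω hω
    exact IsBackwardSol.sub (L := mediumAdj ha hμ ω) hω (isBackwardSol_mediumLim ha hμ ω)
  have key : ∀ s, ∀ᵐ ω ∂P, massNorm (q ω s - mediumLim ha hμ ω s) = 0 := by
    intro s
    refine ae_eq_zero_of_le_pow_mul_comp (T := fun k : ℕ => τ k) (fun k => hτ k) ?_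
      (fun ω => massNorm_nonneg _) (sub_nonneg.2 hδ1.le) (sub_lt_self 1 hδ) fun k => ?_
    · exact (continuous_massNorm.comp_aestronglyMeasurable ((hq.measurable s).sub
        (stronglyMeasurable_mediumLim ha hμ s).aestronglyMeasurable)).aemeasurable
    · filter_upwards [hmass0, hsol, hq.stationary k] with ω h0 h1 h2
      have h3 := hcontr ω (s + k) _ (h1.mono (subset_univ _)) (h0 _) k s le_rfl
      rwa [h2, mediumLim_shift] at h3
  -- One null set suffices for countably many times; any real `s` lies below some `n`, and a
  -- solution vanishing at `n` vanishes before it.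
  have key' : ∀ᵐ ω ∂P, ∀ n : ℕ, massNorm (q ω n - mediumLim ha hμ ω n) = 0 :=
    ae_all_iff.2 fun n => key n
  filter_upwards [key', hsol] with ω h1 h2 s
  obtain ⟨n, hn⟩ := exists_nat_ge s
  exact sub_eq_zero.1 ((h2.mono (subset_univ (Iic (n : ℝ)))).eq_zero (norm_mediumAdj_le ha hμ ω)
    (massNorm_eq_zero (h1 n)) hn)

end Uniqueness

end

theorem proposition3p1 {d : ℕ} {Ω : Type*} [MeasurableSpace Ω] (P : Measure Ω)
    [IsProbabilityMeasure P] (a : EuclideanSpace ℝ (Fin d) → ℝ) (ha : IsJumpKernel a)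
    (τ : ℝ → Ω → Ω) (hτ : IsErgodicFlow P τ) (α₁ α₂ : ℝ)
    (μ : Ω → ℝ → Torus d → Torus d → ℝ) (hμ : IsStationaryMedium τ α₁ α₂ μ) :
    -- the terminal value problems that define `p^N` are uniquely solvable
    (∀ (ω : Ω) (N : ℝ), ∃ p : ℝ → L2T d, IsTerminalSolution (mediumOp ha hμ ω) N p ∧
      ∀ q : ℝ → L2T d, IsTerminalSolution (mediumOp ha hμ ω) N q → EqOn q p (Iic N)) ∧
    ∃ pinf : Ω → ℝ → L2T d,
      -- `p_∞(·, s) = lim p^N(·, s)` in `L²(𝕋^d)` as `N → ∞`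
      (∀ (ω : Ω) (pN : ℝ → ℝ → L2T d),
        (∀ N, IsTerminalSolution (mediumOp ha hμ ω) N (pN N)) →
          ∀ s : ℝ, Tendsto (fun N => pN N s) atTop (𝓝 (pinf ω s))) ∧
      -- `p_∞` is a stationary solution, and this holds for every realization
      IsStationarySolution P τ (mediumOp ha hμ) pinf ∧
      (∀ ω, IsBackwardSolution (mediumOp ha hμ ω) univ (pinf ω)) ∧
      (∀ ω s t, pinf ω (t + s) = pinf (τ s ω) t) ∧
      -- `p_∞ ∈ C(ℝ; L²(𝕋^d))`
      (∀ ω, Continuous (pinf ω)) ∧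
      -- normalization
      (∀ ω s, ∫ ξ, pinf ω s ξ = 1) ∧
      -- deterministic bounds
      (∃ π₁ π₂ : ℝ, 0 < π₁ ∧ ∀ ω s, ∀ᵐ ξ, π₁ ≤ pinf ω s ξ ∧ pinf ω s ξ ≤ π₂) ∧
      -- uniqueness among the normalized stationary solutions
      (∀ q : Ω → ℝ → L2T d, IsStationarySolution P τ (mediumOp ha hμ) q →
        (∀ᵐ ω ∂P, ∀ s, ∫ ξ, q ω s ξ = 1) → ∀ᵐ ω ∂P, ∀ s, q ω s = pinf ω s) := by
  have hsol : ∀ ω N, IsTerminalSolution (mediumOp ha hμ ω) N (mediumSol ha hμ ω N (oneT d)) :=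
    fun ω N => ⟨isBackwardSol_mediumSol ha hμ ω N _, mediumSol_terminal ha hμ ω N _⟩
  have huniq : ∀ ω N q, IsTerminalSolution (mediumOp ha hμ ω) N q →
      EqOn q (mediumSol ha hμ ω N (oneT d)) (Iic N) := by
    intro ω N q hq s hs
    have h : q s = mediumSol ha hμ ω N (q N) s :=
      IsBackwardSol.eq_mediumSol ha hμ hq.1 hs
    rwa [hq.2] at h
  refine ⟨fun ω N => ⟨_, hsol ω N, huniq ω N⟩, mediumLim ha hμ, fun ω pN hpN s => ?_, ?_,
    isBackwardSol_mediumLim ha hμ, mediumLim_shift ha hμ, continuous_mediumLim ha hμ,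
    fun ω s => ?_, exists_mediumLim_bounds ha hμ,
    fun q hq hmass => hq.ae_eq_mediumLim ha hτ.measurePreserving hμ hmass⟩
  -- A terminal solution is determined only on `Iic N`, which contains `s` for all large `N`.
  · refine (tendsto_mediumSol ha hμ ω s).congr' ?_
    filter_upwards [eventually_ge_atTop s] with N hN
    exact (huniq ω N _ (hpN N) hN).symm
  · exact ⟨fun s => (stronglyMeasurable_mediumLim ha hμ s).aestronglyMeasurable,
      Eventually.of_forall (isBackwardSol_mediumLim ha hμ),
      fun s => Eventually.of_forall fun ω t => mediumLim_shift ha hμ ω s t⟩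
  · rw [← inner_oneT, inner_oneT_mediumLim]
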